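/- Let $0\le d\le k$ and $B_{\max}\ge 1$ be integers and $q\in[0,1]$. **Codes.** A type-1 $(d,k)$-RLL machine has states $0,\dots,k$ (the length of the current run of ones). In state $j$, sending the symbol $1$ leads to state $j+1$ and sending $0$ leads to state $0$. Given $\mathcal P=(p_d,\dots,p_{k-1})\in(0,1)^{k-d}$, the symbol $1$ is sent in state $j$ with probability $1$ if $j<d$, $p_j$ if $d\le j<k$, and $0$ if $j=k$. This Markov chain of states has a unique steady-state distribution $\pi=(\pi_j)_{0\le j\le k}$. For each blocklength $n$, $M_n\ge 1$ codewords $x^n(m)$ are drawn independently from the corresponding stationary chain; the message $m$ is uniform on $\{1,\dots,M_n\}$, the channel is noiseless ($Y_i=X_i$, i.e. $p_{10}=0$), and the decoder knows the codebook. **Energy.** The usage $Z_i\in\{0,1\}$ is i.i.d. with $\Pr[Z_i=1]=q$, independent of the code. The battery starts at an arbitrary level $B_1\in\{0,\dots,B_{\max}\}$ and evolves as $B_{i+1}=\min(B_{\max},(B_i+Y_i-Z_i)^+)$; $O_i=1\{B_i=B_{\max},Y_i=1,Z_i=0\}$ and $U_i=1\{B_i=0,Y_i=0,Z_i=1\}$.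 A triple $(R,P_{of},P_{uf})\in\mathbb R^3$ is achievable for type-1 $(d,k)$-RLL codes if for some $\mathcal P$ there are $M_n$ with $\liminf_n \frac1n\log_2M_n\ge R$ and decoders such that, averaged over the ensemble of codebooks, $\Pr[\hat M\ne M]\to0$, $\limsup_n\frac1n\sum_{i=1}^n E[O_i]\le P_{of}$ and $\limsup_n\frac1n\sum_{i=1}^nE[U_i]\le P_{uf}$. **Renewals.** A renewal interval is the time between consecutive visits to state $0$; it carries $I-1$ ones followed by a zero, where $I$ has distribution $p_I(i)=(1-p_{i-1})\prod_{l=d}^{i-2}p_l$ for $d+1\le i\le k$, $p_I(k+1)=\prod_{l=d}^{k-1}p_l$, and $p_I(i)=0$ otherwise; $E[I]=\sum_{i=d+1}^{k+1}i\,p_I(i)$. Let $\tilde O_b$ and $\tilde U_b$ be the numbers of overflows and underflows in a renewal interval that starts with battery level $b$, and let $\tilde\pi=(\tilde\pi_b)_{0\le b\le B_{\max}}$ be a steady-state distribution of the Markov chain of battery levels at the renewal instants (it exists, and it is unique unless $q=0$ and $k=0$). Write $\mathrm H(a)=-a\log_2a-(1-a)\log_2(1-a)$ and $p(n;i,r)=\binom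 inr^n(1-r)^{i-n}$. **Claim.** The set of achievable triples for type-1 $(d,k)$-RLL codes is $$\Bigl\{(R,P_{of},P_{uf}):\ \exists\,\mathcal P\in(0,1)^{k-d}\text{ such that } R\le\sum_{j=d}^{k-1}\pi_j\mathrm H(p_j),\quad P_{of}\ge\frac{\sum_{b=0}^{B_{\max}}\tilde\pi_bE[\tilde O_b]}{E[I]},\quad P_{uf}\ge\frac{\tilde\pi_0E[\tilde U_0]}{E[I]}\Bigr\},$$ where $$E[\tilde U_0]=\sum_{i=d+1}^{k+1}p_I(i)\,p(0;i,1-q),\qquad E[\tilde O_b]=\sum_{i=d+1}^{k+1}p_I(i)\sum_{l=1}^{i-1-(B_{\max}-b)}l\;p\bigl(l+B_{\max}-b;\,i-1,\,1-q\bigr)\quad(0\le b\le B_{\max}).$$ -/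

import Mathlib

open Filter Topology

noncomputable section

namespace EnergyRLL

/-- Binary entropy function, in bits. -/
def binH (a : ℝ) : ℝ := -a * Real.logb 2 a - (1 - a) * Real.logb 2 (1 - a)

/-- `p(n; i, r) = C(i,n) r^n (1-r)^(i-n)`: the binomial distribution with parameters `(i, r)`. -/
def binom (n i : ℕ) (r : ℝ) : ℝ := (i.choose n : ℝ) * r ^ n * (1 - r) ^ (i - n)

/-- `μ` is a steady-state (stationary) probability distribution of the finite Markov chain with
transition probabilities `P i j = Pr[next state = j | current state = i]`. -/
structure IsSteadyState {ι : Type*} [Fintype ι] (P : ι → ι → ℝ) (μ : ι → ℝ) : Prop where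
  nonneg : ∀ i, 0 ≤ μ i
  sum_eq_one : ∑ i, μ i = 1
  balance : ∀ j, ∑ i, μ i * P i j = μ j

section Code

/-! Symbols are Booleans: `true` is the energy-carrying symbol `1`, `false` is the symbol `0`.
The parameters `𝒫 = {p_d, …, p_{k-1}}` are given by a function `p : ℕ → ℝ`, of which only the values
at `d, …, k-1` are ever used. -/

variable (d k : ℕ) (p : ℕ → ℝ)

/-- `𝒫 = {p_d, …, p_{k-1}} ∈ (0,1)^{k-d}`. -/
def Admissible : Prop := ∀ j, d ≤ j → j < k → 0 < p j ∧ p j < 1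

/-- The probability of sending `1` (so moving from state `j` to state `j+1`) in state `j` of the
type-1 `(d,k)` machine: forced for `j < d`, `p_j` for `d ≤ j < k`, impossible for `j = k`. -/
def up (j : ℕ) : ℝ := if j < d then 1 else if j < k then p j else 0

/-- The probability of the edge labelled `x` from state `s` to state `s'` of the type-1 `(d,k)`
machine with states `0, …, k`: the state is the length of the current run of ones; the symbol `1`
leads from `s` to `s + 1`, and the symbol `0` leads from `s` to `0`. -/
def edge (s : Fin (k + 1)) (x : Bool) (s' : Fin (k + 1)) : ℝ :=
  if x = true ∧ (s' : ℕ) = s + 1 then up d k p s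
  else if x = false ∧ (s' : ℕ) = 0 then 1 - up d k p s
  else 0

/-- The transition probabilities of the code state `C_i`. -/
def codeTrans (s s' : Fin (k + 1)) : ℝ := ∑ x : Bool, edge d k p s x s'

/-- The probability that the Markov chain on the type-1 `(d,k)` machine, started from the
distribution `π`, emits the word `x` of length `n`; the sum is over the state sequences
`C_1, …, C_{n+1}`. -/
def wordProb (π : Fin (k + 1) → ℝ) {n : ℕ} (x : Fin n → Bool) : ℝ :=
  ∑ s : Fin (n + 1) → Fin (k + 1), π (s 0) * ∏ i : Fin n, edge d k p (s i.castSucc) (x i) (s i.succ)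

/-- The distribution `p_I` of the length of a renewal interval, that is, of the time between two
consecutive visits of the code state to `0`. -/
def pI (i : ℕ) : ℝ :=
  if d + 1 ≤ i ∧ i ≤ k then (1 - p (i - 1)) * ∏ l ∈ Finset.Ico d (i - 1), p l
  else if i = k + 1 then ∏ l ∈ Finset.Ico d k, p l
  else 0

/-- `E[I]`, the mean length of a renewal interval. -/
def meanI : ℝ := ∑ i ∈ Finset.Icc (d + 1) (k + 1), (i : ℝ) * pI d k p i

end Code

section Battery

/-- One step of the battery: `min(Bmax, (b + y - z)^+)`. The subtraction of natural numbers is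
truncated at `0`, which is the positive part. -/
def batteryStep (Bmax b : ℕ) (y z : Bool) : ℕ := min Bmax (b + y.toNat - z.toNat)

/-- The battery level before channel use number `t` (channel uses are numbered from `0`), with
initial level `b`, received symbols `y` and energy usage `z`. -/
def battery (Bmax b : ℕ) (y z : ℕ → Bool) : ℕ → ℕ
  | 0 => b
  | t + 1 => batteryStep Bmax (battery Bmax b y z t) (y t) (z t)

/-- Indicator of an overflow at time `t`: full battery, energy received, no energy used. -/
def overflow (Bmax b : ℕ) (y z : ℕ → Bool) (t : ℕ) : ℝ :=
  if battery Bmax b y z t = Bmax ∧ y t = true ∧ z t = false then 1 else 0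

/-- Indicator of an underflow at time `t`: empty battery, no energy received, energy required. -/
def underflow (Bmax b : ℕ) (y z : ℕ → Bool) (t : ℕ) : ℝ :=
  if battery Bmax b y z t = 0 ∧ y t = false ∧ z t = true then 1 else 0

/-- A word of length `n` as a sequence; the values at times `≥ n` are irrelevant below. -/
def pad {n : ℕ} (x : Fin n → Bool) (t : ℕ) : Bool := if h : t < n then x ⟨t, h⟩ else false

/-- Expectation over `n` i.i.d. energy usages `Z_i` with `Pr[Z_i = 1] = q`. -/
def usageMean (q : ℝ) (n : ℕ) (f : (Fin n → Bool) → ℝ) : ℝ :=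
  ∑ z : Fin n → Bool, (∏ i, if z i = true then q else 1 - q) * f z

end Battery

section Renewal

variable (d k : ℕ) (p : ℕ → ℝ) (Bmax : ℕ) (q : ℝ)

/-- The symbols in a renewal interval of length `i` of a type-1 code: `i - 1` ones, then a zero. -/
def renewalWord (i : ℕ) (t : ℕ) : Bool := decide (t + 1 < i)

/-- Transition probabilities of the battery level observed at the renewal instants. -/
def renewalTrans (b b' : Fin (Bmax + 1)) : ℝ :=
  ∑ i ∈ Finset.Icc (d + 1) (k + 1), pI d k p i *
    usageMean q i (fun z => if battery Bmax b (renewalWord i) (pad z) i = b' then 1 else 0)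

/-- The mean number of overflows in a renewal interval that starts with battery level `b`. -/
def meanO (b : ℕ) : ℝ :=
  ∑ i ∈ Finset.Icc (d + 1) (k + 1), pI d k p i *
    usageMean q i (fun z => ∑ t ∈ Finset.range i, overflow Bmax b (renewalWord i) (pad z) t)

/-- The mean number of underflows in a renewal interval that starts with battery level `b`. -/
def meanU (b : ℕ) : ℝ :=
  ∑ i ∈ Finset.Icc (d + 1) (k + 1), pI d k p i *
    usageMean q i (fun z => ∑ t ∈ Finset.range i, underflow Bmax b (renewalWord i) (pad z) t)

end Renewal

section Ensemble

/-- Expectation of `f c m` when the `M` codewords `c 0, …, c (M-1)` of length `n` are drawn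
independently with word probabilities `W`, and the message `m` is uniform. -/
def ensembleMean {n : ℕ} (W : (Fin n → Bool) → ℝ) (M : ℕ)
    (f : (Fin M → Fin n → Bool) → Fin M → ℝ) : ℝ :=
  ∑ c : Fin M → Fin n → Bool, (∏ m, W (c m)) * ((1 / (M : ℝ)) * ∑ m, f c m)

/-- Probability of a decoding error over the noiseless channel, averaged over the ensemble. The
decoder `g` knows the codebook `c` and receives the word that was sent. -/
def errorProb {n : ℕ} (W : (Fin n → Bool) → ℝ) (M : ℕ)
    (g : (Fin M → Fin n → Bool) → (Fin n → Bool) → Fin M) : ℝ :=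
  ensembleMean W M (fun c m => if g c (c m) = m then 0 else 1)

/-- `(1/n) ∑ E[O_i]` over the `n` channel uses, expectation over codebook, message and energy usage;
`b` is the initial battery level. -/
def overflowRate {n : ℕ} (W : (Fin n → Bool) → ℝ) (M Bmax b : ℕ) (q : ℝ) : ℝ :=
  (1 / (n : ℝ)) * ∑ t ∈ Finset.range n,
    ensembleMean W M (fun c m => usageMean q n (fun z => overflow Bmax b (pad (c m)) (pad z) t))

/-- `(1/n) ∑ E[U_i]` over the `n` channel uses, expectation over codebook, message and energy usage;
`b` is the initial battery level. -/
def underflowRate {n : ℕ} (W : (Fin n → Bool) → ℝ) (M Bmax b : ℕ) (q : ℝ) : ℝ :=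
  (1 / (n : ℝ)) * ∑ t ∈ Finset.range n,
    ensembleMean W M (fun c m => usageMean q n (fun z => underflow Bmax b (pad (c m)) (pad z) t))

/-- The triples `(R, P_of, P_uf)` that are achievable, over the noiseless channel, with type-1
`(d,k)`-RLL codes: for some `𝒫`, the ensembles of codes whose codewords are drawn independently from
the stationary Markov chain with parameters `𝒫` on the type-1 `(d,k)` machine, with numbers of
messages `M n` of asymptotic rate at least `R` (`liminf (1/n) log₂ (M n) ≥ R`), have vanishing error
probability for some decoders, and overflow and underflow probabilities at most `P_of` and `P_uf`. -/
def achievableTriples (d k Bmax b : ℕ) (q : ℝ) : Set (ℝ × ℝ × ℝ) :=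
  {T | ∃ (p : ℕ → ℝ) (π : Fin (k + 1) → ℝ),
    Admissible d k p ∧ IsSteadyState (codeTrans d k p) π ∧
    ∃ (M : ℕ → ℕ) (g : ∀ n, (Fin (M n) → Fin n → Bool) → (Fin n → Bool) → Fin (M n)),
      (∀ n, 1 ≤ M n) ∧
      (∀ R' < T.1, ∀ᶠ n : ℕ in atTop, (2 : ℝ) ^ ((n : ℝ) * R') ≤ (M n : ℝ)) ∧
      Tendsto (fun n => errorProb (wordProb d k p π (n := n)) (M n) (g n)) atTop (𝓝 0) ∧
      limsup (fun n => overflowRate (wordProb d k p π (n := n)) (M n) Bmax b q) atTop ≤ T.2.1 ∧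
      limsup (fun n => underflowRate (wordProb d k p π (n := n)) (M n) Bmax b q) atTop ≤ T.2.2}

end Ensemble

end EnergyRLL

end

open EnergyRLL

/-! For fixed `p` the energy constraints and the rate decouple. The transmitted codeword has the law
of the stationary chain whatever the number of messages is (`ensembleMean_const`), so the overflow
and underflow rates depend only on the chain and the usage, and they converge; rate and decoding
error do not involve the battery.

Energy is a renewal-reward argument carried out with Poisson equations. Let `c` be the mean reward
per interval divided by the mean interval length. At the renewal instants the centred reward has
mean zero, so the Poisson equation is solvable (`exists_poisson`). Continuing its solution inside
the intervals by `potential` solves the Poisson equation of the joint chain of code state and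
battery level (`exists_joint_poisson`). Hence the mean reward over `n` uses is `c * n` up to a
bounded error, from every initial state (`exists_rewardFrom_bound`). The binomial formulas come from
recursions over one interval (`intervalMean_underflow`, `intervalMean_overflow`).

The rate threshold is the entropy rate. Another Poisson equation turns the self-information of a
word into a martingale up to bounded terms, so its variance is at most linear in `n`
(`exists_wordInfo_variance`), and word probabilities concentrate near `2 ^ (-n H)` on the
exponential scale. Without noise only colliding codewords cause errors, and below the threshold
collisions are rare (`exists_decoder_errorProb_le`). Conversely, correctly decoded messages have
distinct codewords and there are few likely words, so above the threshold the lower bound on the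
error probability tends to one (`le_errorProb`). -/

namespace EnergyRLL

/-! ### Finite Markov chains: steady states and the Poisson equation -/

section MarkovChain

variable {ι : Type*} [Fintype ι] {P : ι → ι → ℝ}

/-- The absolute value of a signed invariant vector of a stochastic matrix is invariant. -/
lemma abs_balance (h0 : ∀ i j, 0 ≤ P i j) (h1 : ∀ i, ∑ j, P i j = 1) {μ : ι → ℝ}
    (hμ : ∀ j, ∑ i, μ i * P i j = μ j) (j : ι) : ∑ i, |μ i| * P i j = |μ j| := by
  have hle : ∀ j ∈ Finset.univ, |μ j| ≤ ∑ i, |μ i| * P i j := by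
    intro j _
    rw [← hμ j]
    refine (Finset.abs_sum_le_sum_abs _ _).trans (le_of_eq ?_)
    exact Finset.sum_congr rfl fun i _ => by rw [abs_mul, abs_of_nonneg (h0 i j)]
  have hs : ∑ j, |μ j| = ∑ j, ∑ i, |μ i| * P i j := by
    rw [Finset.sum_comm]
    exact Finset.sum_congr rfl fun i _ => by rw [← Finset.mul_sum, h1, mul_one]
  exact ((Finset.sum_eq_sum_iff_of_le hle).1 hs j (Finset.mem_univ j)).symm

/-- The matrix `1 - P` kills the constants, so it is singular and has a nonzero left null vector.
Its absolute value is again invariant by `abs_balance` and can be normalised. -/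
lemma exists_isSteadyState [Nonempty ι] (h0 : ∀ i j, 0 ≤ P i j) (h1 : ∀ i, ∑ j, P i j = 1) :
    ∃ μ, IsSteadyState P μ := by
  classical
  let A : Matrix ι ι ℝ := 1 - Matrix.of P
  have hdet : A.det = 0 := by
    rw [← Matrix.exists_mulVec_eq_zero_iff]
    refine ⟨fun _ => 1, fun h => one_ne_zero (congrFun h (Classical.arbitrary ι)), ?_⟩
    ext i
    simp only [A, Matrix.sub_mulVec, Matrix.one_mulVec]
    simp [Matrix.mulVec, dotProduct, h1]
  obtain ⟨v, hv, hvA⟩ := Matrix.exists_vecMul_eq_zero_iff.2 hdet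
  have hb : ∀ j, ∑ i, v i * P i j = v j := by
    intro j
    have := congrFun hvA j
    simp only [A, Matrix.vecMul_sub, Matrix.vecMul_one, Pi.sub_apply, Pi.zero_apply] at this
    simp only [Matrix.vecMul, dotProduct, Matrix.of_apply] at this
    linarith
  have hpos : 0 < ∑ i, |v i| := by
    obtain ⟨i, hi⟩ := Function.ne_iff.1 hv
    exact Finset.sum_pos' (fun _ _ => abs_nonneg _) ⟨i, Finset.mem_univ i, abs_pos.2 hi⟩
  refine ⟨fun i => |v i| / ∑ i, |v i|, fun i => by positivity, ?_, fun j => ?_⟩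
  · rw [← Finset.sum_div, div_self hpos.ne']
  · simp only [div_mul_eq_mul_div]
    rw [← Finset.sum_div, abs_balance h0 h1 hb]

lemma pos_of_accessible (h0 : ∀ i j, 0 ≤ P i j) {μ : ι → ℝ} (hn : ∀ i, 0 ≤ μ i)
    (hμ : ∀ j, ∑ i, μ i * P i j = μ j) {i a : ι}
    (h : Relation.ReflTransGen (fun i j => 0 < P i j) i a) (hi : 0 < μ i) : 0 < μ a := by
  induction h with
  | refl => exact hi
  | @tail b c _ hbc ih =>
    rw [← hμ c]
    exact Finset.sum_pos' (fun i _ => mul_nonneg (hn i) (h0 i c))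
      ⟨b, Finset.mem_univ b, mul_pos ih hbc⟩

/-- The difference `l` of two steady states has one sign: if `l` and `-l` were both positive
somewhere, both would be positive at `a`. Since its entries sum to zero, it vanishes. -/
lemma existsUnique_isSteadyState [Nonempty ι] (h0 : ∀ i j, 0 ≤ P i j) (h1 : ∀ i, ∑ j, P i j = 1)
    {a : ι} (ha : ∀ i, Relation.ReflTransGen (fun i j => 0 < P i j) i a) :
    ∃! μ, IsSteadyState P μ := by
  obtain ⟨μ, hμ⟩ := exists_isSteadyState h0 h1
  refine ⟨μ, hμ, fun ν hν => ?_⟩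
  set l : ι → ℝ := fun i => ν i - μ i with hl
  have hbal : ∀ j, ∑ i, l i * P i j = l j := fun j => by
    simp only [hl, sub_mul, Finset.sum_sub_distrib, hμ.balance, hν.balance]
  have habs := abs_balance h0 h1 hbal
  have hsum : ∑ i, l i = 0 := by
    simp [hl, Finset.sum_sub_distrib, hμ.sum_eq_one, hν.sum_eq_one]
  have key : ∀ m : ι → ℝ, (∀ j, ∑ i, m i * P i j = m j) → (∀ j, ∑ i, |m i| * P i j = |m j|) →
      ∀ i, 0 < m i → 0 < m a := by
    intro m hm hm' i hi
    -- Twice the positive part of `m` is a nonnegative invariant vector, so its positivity spreads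
    -- to `a`.
    have := pos_of_accessible (μ := fun i => |m i| + m i) h0
      (fun i => by linarith [neg_abs_le (m i)])
      (fun j => by simp only [add_mul, Finset.sum_add_distrib, hm, hm']) (ha i)
      (by have := abs_nonneg (m i); linarith)
    by_contra hc
    rw [abs_of_nonpos (not_lt.1 hc)] at this
    linarith
  have hz : ∀ i, l i = 0 := by
    rcases le_or_gt (l a) 0 with h | h
    · have hle : ∀ i, l i ≤ 0 := fun i => not_lt.1 fun hi => absurd (key l hbal habs i hi) h.not_gt
      exact fun i => (Finset.sum_eq_zero_iff_of_nonpos fun i _ => hle i).1 hsum i (Finset.mem_univ i)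
    · have hle : ∀ i, 0 ≤ l i := fun i => not_lt.1 fun hi => by
        have := key (fun i => -l i) (fun j => by simp [hbal]) (fun j => by simp [habs])
          i (by linarith)
        linarith
      exact fun i => (Finset.sum_eq_zero_iff_of_nonneg fun i _ => hle i).1 hsum i (Finset.mem_univ i)
  exact funext fun i => by have := hz i; simp only [hl] at this; linarith

/-- A harmonic function takes at an accessible state a value at least its maximum. -/
lemma harmonic_le (h0 : ∀ i j, 0 ≤ P i j) (h1 : ∀ i, ∑ j, P i j = 1) {a : ι}
    (ha : ∀ i, Relation.ReflTransGen (fun i j => 0 < P i j) i a) {f : ι → ℝ}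
    (hf : ∀ i, ∑ j, P i j * f j = f i) (i : ι) : f i ≤ f a := by
  have : Nonempty ι := ⟨a⟩
  obtain ⟨m, hm⟩ := Finite.exists_max f
  suffices ∀ b, Relation.ReflTransGen (fun i j => 0 < P i j) m b → f b = f m by
    rw [this a (ha m)]; exact hm i
  intro b hb
  induction hb with
  | refl => rfl
  | @tail b c _ hbc ih =>
    have hs : ∑ j, P b j * (f m - f j) = 0 := by
      simp only [mul_sub, Finset.sum_sub_distrib, hf, ← Finset.sum_mul, h1, ih]; ring
    have := (Finset.sum_eq_zero_iff_of_nonneg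
      (fun j _ => mul_nonneg (h0 b j) (sub_nonneg.2 (hm j)))).1 hs c (Finset.mem_univ c)
    rcases mul_eq_zero.1 this with h | h
    · exact absurd h hbc.ne'
    · linarith

/-- Solvability of the Poisson equation of a finite Markov chain with a state that is accessible
from every state. -/
lemma exists_poisson (h0 : ∀ i j, 0 ≤ P i j) (h1 : ∀ i, ∑ j, P i j = 1) {a : ι}
    (ha : ∀ i, Relation.ReflTransGen (fun i j => 0 < P i j) i a) {μ : ι → ℝ}
    (hμ : IsSteadyState P μ) (f : ι → ℝ) (hf : ∑ i, μ i * f i = 0) :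
    ∃ h : ι → ℝ, ∀ i, h i = f i + ∑ j, P i j * h j := by
  classical
  let T : (ι → ℝ) →ₗ[ℝ] (ι → ℝ) := LinearMap.id - (Matrix.of P).mulVecLin
  have hT : ∀ h i, T h i = h i - ∑ j, P i j * h j := fun h i => by
    simp [T, Matrix.mulVec, dotProduct]
  let φ : (ι → ℝ) →ₗ[ℝ] ℝ := ∑ i, μ i • LinearMap.proj i
  have hφ : ∀ h, φ h = ∑ i, μ i * h i := fun h => by simp [φ]
  have hker : LinearMap.ker T = Submodule.span ℝ {fun _ : ι => (1 : ℝ)} := by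
    ext v
    rw [LinearMap.mem_ker, Submodule.mem_span_singleton]
    constructor
    · intro hv
      have hv' : ∀ i, ∑ j, P i j * v j = v i := fun i => by
        have := congrFun hv i
        rw [hT] at this
        simp only [Pi.zero_apply] at this
        linarith
      refine ⟨v a, funext fun i => ?_⟩
      have e1 := harmonic_le h0 h1 ha hv' i
      have e2 := harmonic_le h0 h1 ha (f := fun i => -v i) (fun i => by simp [hv']) i
      simp only [Pi.smul_apply, smul_eq_mul, mul_one]
      linarith
    · rintro ⟨c, rfl⟩
      ext i
      rw [hT]
      simp [← Finset.sum_mul, h1]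
  have hle : LinearMap.range T ≤ LinearMap.ker φ := by
    rintro _ ⟨h, rfl⟩
    rw [LinearMap.mem_ker, hφ]
    simp only [hT, mul_sub, Finset.sum_sub_distrib, Finset.mul_sum]
    rw [Finset.sum_comm, sub_eq_zero]
    refine Finset.sum_congr rfl fun j _ => ?_
    rw [← hμ.balance j, Finset.sum_mul]
    exact Finset.sum_congr rfl fun i _ => mul_assoc _ _ _
  have hone : (fun _ : ι => (1 : ℝ)) ≠ 0 := fun h => one_ne_zero (congrFun h a)
  have hφr : LinearMap.range φ = ⊤ := by
    rw [LinearMap.range_eq_top]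
    intro c
    exact ⟨fun _ => c, by rw [hφ, ← Finset.sum_mul, hμ.sum_eq_one, one_mul]⟩
  -- The kernel of `T` and the range of `φ` both have dimension one, so `range T` and `ker φ` have
  -- equal dimension and the inclusion is an equality.
  have e1 := LinearMap.finrank_range_add_finrank_ker T
  have e2 := LinearMap.finrank_range_add_finrank_ker φ
  rw [hker, finrank_span_singleton hone] at e1
  rw [hφr, finrank_top, Module.finrank_self] at e2
  have heq := Submodule.eq_of_le_of_finrank_eq hle (by omega)
  have hmem : f ∈ LinearMap.range T := by
    rw [heq, LinearMap.mem_ker, hφ, hf]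
  obtain ⟨h, hh⟩ := hmem
  refine ⟨h, fun i => ?_⟩
  have := congrFun hh i
  rw [hT] at this
  linarith

end MarkovChain

/-! ### Splitting off the first letter of a word -/

section FiniteWords

lemma sum_cons {n : ℕ} {α : Type*} [Fintype α] (F : (Fin (n + 1) → α) → ℝ) :
    ∑ x, F x = ∑ a : α, ∑ x : Fin n → α, F (Fin.cons a x) := by
  rw [← (Fin.consEquiv fun _ : Fin (n + 1) => α).sum_comp, Fintype.sum_prod_type]
  rfl

end FiniteWords

/-! ### Word probabilities of the type-1 machine -/

section Code

variable {d k : ℕ} {p : ℕ → ℝ}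

/-- The successor of the state `s` of the type-1 machine under the symbol `x`. -/
def codeNext {k : ℕ} (s : Fin (k + 1)) (x : Bool) : Fin (k + 1) :=
  if h : x = true ∧ (s : ℕ) + 1 < k + 1 then ⟨s + 1, h.2⟩ else 0

/-- The probability of the symbol `x` in state `s` of the type-1 machine. -/
def codeProb (d k : ℕ) (p : ℕ → ℝ) (s : ℕ) (x : Bool) : ℝ :=
  if x = true then up d k p s else 1 - up d k p s

/-- The probability that the machine emits `x` when started in state `s`. -/
def wordFrom (d k : ℕ) (p : ℕ → ℝ) : (n : ℕ) → Fin (k + 1) → (Fin n → Bool) → ℝ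
  | 0, _, _ => 1
  | n + 1, s, x => codeProb d k p s (x 0) * wordFrom d k p n (codeNext s (x 0)) (Fin.tail x)

lemma wordFrom_cons {n : ℕ} (s : Fin (k + 1)) (a : Bool) (x : Fin n → Bool) :
    wordFrom d k p (n + 1) s (Fin.cons a x) =
      codeProb d k p s a * wordFrom d k p n (codeNext s a) x := rfl

lemma up_nonneg (hp : Admissible d k p) (j : ℕ) : 0 ≤ up d k p j := by
  unfold up
  split_ifs with h1 h2
  · exact zero_le_one
  · exact (hp j (not_lt.1 h1) h2).1.le
  · exact le_rfl

lemma up_le_one (hp : Admissible d k p) (j : ℕ) : up d k p j ≤ 1 := by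
  unfold up
  split_ifs with h1 h2
  · exact le_rfl
  · exact (hp j (not_lt.1 h1) h2).2.le
  · exact zero_le_one

lemma up_top (hdk : d ≤ k) : up d k p k = 0 := by simp [up, hdk.not_gt]

lemma up_pos (hp : Admissible d k p) {j : ℕ} (hj : j < k) : 0 < up d k p j := by
  unfold up
  split_ifs with h1
  · exact zero_lt_one
  · exact (hp j (not_lt.1 h1) hj).1

lemma codeProb_nonneg (hp : Admissible d k p) (s : ℕ) (x : Bool) : 0 ≤ codeProb d k p s x := by
  unfold codeProb
  split_ifs
  · exact up_nonneg hp s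
  · exact sub_nonneg.2 (up_le_one hp s)

lemma sum_codeProb (s : ℕ) : ∑ x, codeProb d k p s x = 1 := by simp [codeProb]

lemma codeNext_false (s : Fin (k + 1)) : codeNext s false = 0 := by simp [codeNext]

/-- The machine is deterministic given the symbol, so only one successor contributes. -/
lemma sum_edge (hdk : d ≤ k) (s : Fin (k + 1)) (x : Bool) (F : Fin (k + 1) → ℝ) :
    ∑ s', edge d k p s x s' * F s' = codeProb d k p s x * F (codeNext s x) := by
  rw [Finset.sum_eq_single (codeNext s x)]
  · rcases x with _ | _
    · simp [edge, codeNext, codeProb]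
    · by_cases h : (s : ℕ) + 1 < k + 1
      · simp [edge, codeNext, codeProb, h]
      -- In state `k` the successor under `1` is a default value; it is harmless because this symbol
      -- has probability zero there.
      · have hs : (s : ℕ) = k := by omega
        simp [edge, codeNext, codeProb, hs, up_top hdk]
  · intro s' _ hs'
    have : edge d k p s x s' = 0 := by
      unfold edge
      rw [if_neg, if_neg]
      · rintro ⟨rfl, h⟩
        exact hs' (Fin.ext (by simp [codeNext, h]))
      · rintro ⟨rfl, h⟩
        exact hs' (Fin.ext (by have := s'.2; rw [h] at this; simp [codeNext, h, this]))
    rw [this, zero_mul]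
  · simp

lemma sum_codeTrans (hdk : d ≤ k) (s : Fin (k + 1)) (F : Fin (k + 1) → ℝ) :
    ∑ s', codeTrans d k p s s' * F s' = ∑ x, codeProb d k p s x * F (codeNext s x) := by
  simp only [codeTrans, Finset.sum_mul]
  rw [Finset.sum_comm]
  exact Finset.sum_congr rfl fun x _ => sum_edge hdk s x F

lemma edge_nonneg (hp : Admissible d k p) (s : Fin (k + 1)) (x : Bool) (s' : Fin (k + 1)) :
    0 ≤ edge d k p s x s' := by
  unfold edge
  split_ifs
  · exact up_nonneg hp s
  · exact sub_nonneg.2 (up_le_one hp s)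
  · exact le_rfl

lemma codeTrans_nonneg (hp : Admissible d k p) (s s' : Fin (k + 1)) : 0 ≤ codeTrans d k p s s' :=
  Finset.sum_nonneg fun x _ => edge_nonneg hp s x s'

lemma codeTrans_sum (hdk : d ≤ k) (s : Fin (k + 1)) : ∑ s', codeTrans d k p s s' = 1 := by
  have := sum_codeTrans (p := p) hdk s fun _ => 1
  simpa only [mul_one, sum_codeProb] using this

/-- A zero may be forbidden in state `s`, but climbing by ones to state `k` is always possible, and
there the zero is forced. -/
lemma codeTrans_accessible (hdk : d ≤ k) (hp : Admissible d k p) (s : Fin (k + 1)) :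
    Relation.ReflTransGen (fun i j => 0 < codeTrans d k p i j) s 0 := by
  have hpos : ∀ (s s' : Fin (k + 1)) (x : Bool), 0 < edge d k p s x s' →
      0 < codeTrans d k p s s' := fun s s' x h =>
    Finset.sum_pos' (fun x _ => edge_nonneg hp s x s') ⟨x, Finset.mem_univ x, h⟩
  suffices ∀ m (s : Fin (k + 1)), (s : ℕ) + m = k →
      Relation.ReflTransGen (fun i j => 0 < codeTrans d k p i j) s 0 from
    this (k - s) s (by omega)
  intro m
  induction m with
  | zero =>
    intro s hs
    refine Relation.ReflTransGen.single (hpos _ _ false ?_)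
    have : (s : ℕ) = k := by omega
    simp [edge, this, up_top hdk]
  | succ m ih =>
    intro s hs
    refine Relation.ReflTransGen.head (b := ⟨s + 1, by omega⟩) (hpos _ _ true ?_)
      (ih _ (by simp; omega))
    simpa [edge] using up_pos hp (by omega)

lemma sum_paths (hdk : d ≤ k) {n : ℕ} (F : Fin (k + 1) → ℝ) (x : Fin n → Bool) :
    ∑ s : Fin (n + 1) → Fin (k + 1),
        F (s 0) * ∏ i : Fin n, edge d k p (s i.castSucc) (x i) (s i.succ) =
      ∑ s, F s * wordFrom d k p n s x := by
  induction n generalizing F with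
  | zero => simp [sum_cons, wordFrom]
  | succ n ih =>
    rw [sum_cons, Finset.sum_comm]
    -- The first transition is absorbed into the initial weight, which is why the induction is over
    -- all `F`.
    have := ih (fun s' => ∑ s, F s * edge d k p s (x 0) s') (Fin.tail x)
    simp only [Fin.prod_univ_succ, Fin.cons_zero, Fin.cons_succ, Fin.castSucc_zero,
      ← Fin.succ_castSucc]
    simp only [Fin.tail, Finset.sum_mul] at this
    simp only [← mul_assoc]
    rw [this, Finset.sum_comm]
    refine Finset.sum_congr rfl fun s _ => ?_
    simp only [mul_assoc]
    rw [← Finset.mul_sum, sum_edge hdk]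
    rfl

lemma wordProb_eq (hdk : d ≤ k) (π : Fin (k + 1) → ℝ) {n : ℕ} (x : Fin n → Bool) :
    wordProb d k p π x = ∑ s, π s * wordFrom d k p n s x :=
  sum_paths hdk π x

lemma wordFrom_nonneg (hp : Admissible d k p) {n : ℕ} (s : Fin (k + 1)) (x : Fin n → Bool) :
    0 ≤ wordFrom d k p n s x := by
  induction n generalizing s with
  | zero => exact zero_le_one
  | succ n ih => exact mul_nonneg (codeProb_nonneg hp _ _) (ih _ _)

lemma sum_wordFrom_succ {n : ℕ} (s : Fin (k + 1)) (F : (Fin (n + 1) → Bool) → ℝ) :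
    ∑ x, wordFrom d k p (n + 1) s x * F x = ∑ a, codeProb d k p s a *
      ∑ x, wordFrom d k p n (codeNext s a) x * F (Fin.cons a x) := by
  rw [sum_cons]
  refine Finset.sum_congr rfl fun a _ => ?_
  rw [Finset.mul_sum]
  exact Finset.sum_congr rfl fun x _ => by rw [wordFrom_cons, mul_assoc]

lemma sum_wordFrom (n : ℕ) (s : Fin (k + 1)) : ∑ x, wordFrom d k p n s x = 1 := by
  induction n generalizing s with
  | zero => simp [wordFrom]
  | succ n ih =>
    have := sum_wordFrom_succ (d := d) (p := p) s fun _ : Fin (n + 1) → Bool => 1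
    simpa only [mul_one, ih, sum_codeProb] using this

lemma sum_wordProb_mul (hdk : d ≤ k) (π : Fin (k + 1) → ℝ) {n : ℕ} (F : (Fin n → Bool) → ℝ) :
    ∑ x, wordProb d k p π x * F x = ∑ s, π s * ∑ x, wordFrom d k p n s x * F x := by
  simp only [wordProb_eq hdk, Finset.sum_mul, Finset.mul_sum]
  rw [Finset.sum_comm]
  exact Finset.sum_congr rfl fun s _ => Finset.sum_congr rfl fun x _ => mul_assoc _ _ _

lemma wordProb_nonneg (hdk : d ≤ k) (hp : Admissible d k p) {π : Fin (k + 1) → ℝ}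
    (hπ : ∀ s, 0 ≤ π s) {n : ℕ} (x : Fin n → Bool) : 0 ≤ wordProb d k p π x := by
  rw [wordProb_eq hdk]
  exact Finset.sum_nonneg fun s _ => mul_nonneg (hπ s) (wordFrom_nonneg hp s x)

lemma sum_wordProb (hdk : d ≤ k) {π : Fin (k + 1) → ℝ} (hπ : ∑ s, π s = 1) (n : ℕ) :
    ∑ x : Fin n → Bool, wordProb d k p π x = 1 := by
  have := sum_wordProb_mul (p := p) hdk π fun _ : Fin n → Bool => 1
  simpa [sum_wordFrom, hπ] using this

end Code

/-! ### Expectation over the energy usage -/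

section Usage

variable {q : ℝ}

/-- The probability of the energy usage `z`. -/
def usageProb (q : ℝ) (z : Bool) : ℝ := if z = true then q else 1 - q

lemma usageProb_nonneg (hq0 : 0 ≤ q) (hq1 : q ≤ 1) (z : Bool) : 0 ≤ usageProb q z := by
  unfold usageProb
  split_ifs <;> linarith

lemma sum_usageProb : ∑ z, usageProb q z = 1 := by simp [usageProb]

lemma usageMean_eq (n : ℕ) (f : (Fin n → Bool) → ℝ) :
    usageMean q n f = ∑ z, (∏ i, usageProb q (z i)) * f z := rfl

lemma usageMean_zero (f : (Fin 0 → Bool) → ℝ) : usageMean q 0 f = f Fin.elim0 := by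
  rw [usageMean_eq, Fintype.sum_unique]
  simp only [Finset.univ_eq_empty, Finset.prod_empty, one_mul]
  exact congrArg f (Subsingleton.elim _ _)

lemma usageMean_succ {n : ℕ} (f : (Fin (n + 1) → Bool) → ℝ) :
    usageMean q (n + 1) f =
      ∑ a, usageProb q a * usageMean q n fun z => f (Fin.cons a z) := by
  simp only [usageMean_eq]
  rw [sum_cons]
  refine Finset.sum_congr rfl fun a _ => ?_
  rw [Finset.mul_sum]
  refine Finset.sum_congr rfl fun z _ => ?_
  rw [Fin.prod_univ_succ]
  simp [mul_assoc]

lemma usageMean_add {n : ℕ} (f g : (Fin n → Bool) → ℝ) :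
    usageMean q n (fun z => f z + g z) = usageMean q n f + usageMean q n g := by
  simp [usageMean_eq, mul_add, Finset.sum_add_distrib]

lemma usageMean_sum {n : ℕ} {ι : Type*} (s : Finset ι) (f : ι → (Fin n → Bool) → ℝ) :
    usageMean q n (fun z => ∑ i ∈ s, f i z) = ∑ i ∈ s, usageMean q n (f i) := by
  simp only [usageMean_eq, Finset.mul_sum]
  exact Finset.sum_comm

lemma usageMean_mul {n : ℕ} (c : ℝ) (f : (Fin n → Bool) → ℝ) :
    usageMean q n (fun z => c * f z) = c * usageMean q n f := by
  simp only [usageMean_eq, Finset.mul_sum]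
  exact Finset.sum_congr rfl fun i _ => by ring

lemma usageMean_one (n : ℕ) : usageMean q n (fun _ => 1) = 1 := by
  induction n with
  | zero => simp [usageMean_zero]
  | succ n ih => simp [usageMean_succ, ih, usageProb]

lemma usageMean_const (n : ℕ) (c : ℝ) : usageMean q n (fun _ => c) = c := by
  have := usageMean_mul (q := q) (n := n) c fun _ => 1
  simpa [usageMean_one] using this

lemma usageMean_nonneg (hq0 : 0 ≤ q) (hq1 : q ≤ 1) {n : ℕ} {f : (Fin n → Bool) → ℝ}
    (hf : ∀ z, 0 ≤ f z) : 0 ≤ usageMean q n f :=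
  Finset.sum_nonneg fun z _ =>
    mul_nonneg (Finset.prod_nonneg fun i _ => usageProb_nonneg hq0 hq1 (z i)) (hf z)

end Usage

/-! ### Battery dynamics and rewards over one interval -/

section Battery

/-- The definition recurses on the last step; peeling off the first one matches the decomposition of
words by `Fin.cons`. -/
lemma battery_succ_eq (Bmax b : ℕ) (y z : ℕ → Bool) (t : ℕ) :
    battery Bmax b y z (t + 1) =
      battery Bmax (batteryStep Bmax b (y 0) (z 0)) (fun i => y (i + 1)) (fun i => z (i + 1)) t := by
  induction t with
  | zero => rfl
  | succ t ih =>
    rw [battery, ih]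
    rfl

lemma batteryStep_le (Bmax b : ℕ) (y z : Bool) : batteryStep Bmax b y z ≤ Bmax := min_le_left _ _

lemma battery_le {Bmax b : ℕ} (hb : b ≤ Bmax) (y z : ℕ → Bool) (t : ℕ) :
    battery Bmax b y z t ≤ Bmax := by
  cases t with
  | zero => exact hb
  | succ t => exact batteryStep_le _ _ _ _

lemma pad_cons_zero {n : ℕ} (a : Bool) (x : Fin n → Bool) :
    pad (Fin.cons a x : Fin (n + 1) → Bool) 0 = a := by simp [pad]

lemma pad_cons_succ {n : ℕ} (a : Bool) (x : Fin n → Bool) (t : ℕ) :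
    pad (Fin.cons a x : Fin (n + 1) → Bool) (t + 1) = pad x t := by
  unfold pad
  by_cases h : t < n
  · rw [dif_pos (by omega), dif_pos h]
    exact Fin.cons_succ (α := fun _ => Bool) a x ⟨t, h⟩
  · rw [dif_neg (by omega), dif_neg h]

/-- The total over the first `n` channel uses of a reward that depends on the battery level, the
received symbol and the energy usage. -/
def total (r : ℕ → Bool → Bool → ℝ) (Bmax b : ℕ) (y z : ℕ → Bool) (n : ℕ) : ℝ :=
  ∑ t ∈ Finset.range n, r (battery Bmax b y z t) (y t) (z t)

lemma total_succ (r : ℕ → Bool → Bool → ℝ) (Bmax b : ℕ) (y z : ℕ → Bool) (n : ℕ) :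
    total r Bmax b y z (n + 1) = r b (y 0) (z 0) +
      total r Bmax (batteryStep Bmax b (y 0) (z 0)) (fun i => y (i + 1)) (fun i => z (i + 1)) n := by
  unfold total
  rw [Finset.sum_range_succ', add_comm]
  simp only [battery_succ_eq]
  rfl

/-- The overflow indicator as a reward. -/
def overflowReward (Bmax b : ℕ) (y z : Bool) : ℝ :=
  if b = Bmax ∧ y = true ∧ z = false then 1 else 0

/-- The underflow indicator as a reward. -/
def underflowReward (b : ℕ) (y z : Bool) : ℝ :=
  if b = 0 ∧ y = false ∧ z = true then 1 else 0

/-- The mean, over the energy usage in a renewal interval of length `i` that starts with battery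
level `b`, of the total reward plus a function of the battery level at the end. -/
def intervalMean (q : ℝ) (r : ℕ → Bool → Bool → ℝ) (Φ : ℕ → ℝ) (Bmax i b : ℕ) : ℝ :=
  usageMean q i fun z => total r Bmax b (renewalWord i) (pad z) i +
    Φ (battery Bmax b (renewalWord i) (pad z) i)

variable {q : ℝ} {r : ℕ → Bool → Bool → ℝ} {Φ : ℕ → ℝ} {Bmax : ℕ}

lemma intervalMean_succ (i b : ℕ) (hi : ∀ t, renewalWord (i + 1) (t + 1) = renewalWord i t) :
    intervalMean q r Φ Bmax (i + 1) b = ∑ z, usageProb q z *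
      (r b (renewalWord (i + 1) 0) z +
        intervalMean q r Φ Bmax i (batteryStep Bmax b (renewalWord (i + 1) 0) z)) := by
  unfold intervalMean
  rw [usageMean_succ]
  refine Finset.sum_congr rfl fun a _ => ?_
  simp only [total_succ, battery_succ_eq, pad_cons_zero, pad_cons_succ, hi]
  simp only [add_assoc]
  rw [usageMean_add, usageMean_const]

lemma intervalMean_one (b : ℕ) :
    intervalMean q r Φ Bmax 1 b =
      ∑ z, usageProb q z * (r b false z + Φ (batteryStep Bmax b false z)) := by
  rw [intervalMean_succ 0 b (by simp [renewalWord])]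
  simp [intervalMean, usageMean_zero, total, battery, renewalWord]

lemma intervalMean_add_two (m b : ℕ) :
    intervalMean q r Φ Bmax (m + 2) b = ∑ z, usageProb q z *
      (r b true z + intervalMean q r Φ Bmax (m + 1) (batteryStep Bmax b true z)) := by
  rw [intervalMean_succ (m + 1) b (by simp [renewalWord])]
  simp [renewalWord]

end Battery

/-! ### The distribution of the interval length -/

section Intervals

variable {d k : ℕ} {p : ℕ → ℝ}

/-- The probability that the machine, started in state `s`, emits `j` ones and then a zero. -/
def exitProb (d k : ℕ) (p : ℕ → ℝ) (s j : ℕ) : ℝ :=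
  (1 - up d k p (s + j)) * ∏ l ∈ Finset.range j, up d k p (s + l)

lemma exitProb_zero (s : ℕ) : exitProb d k p s 0 = 1 - up d k p s := by simp [exitProb]

lemma exitProb_succ (s j : ℕ) :
    exitProb d k p s (j + 1) = up d k p s * exitProb d k p (s + 1) j := by
  unfold exitProb
  rw [Finset.prod_range_succ']
  simp only [add_zero, add_assoc, add_comm 1]
  ring

lemma sum_exitProb (hdk : d ≤ k) (m s : ℕ) (h : s + m = k) :
    ∑ j ∈ Finset.range (m + 1), exitProb d k p s j = 1 := by
  induction m generalizing s with
  | zero =>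
    have : s = k := h
    simp [exitProb_zero, this, up_top hdk]
  | succ m ih =>
    rw [Finset.sum_range_succ']
    simp only [exitProb_succ, exitProb_zero]
    rw [← Finset.mul_sum, ih (s + 1) (by omega)]
    ring

lemma prod_up {j : ℕ} (h1 : d ≤ j) (h2 : j ≤ k) :
    ∏ l ∈ Finset.range j, up d k p l = ∏ l ∈ Finset.Ico d j, p l := by
  rw [← Finset.prod_range_mul_prod_Ico _ h1]
  rw [Finset.prod_eq_one (s := Finset.range d), one_mul]
  · refine Finset.prod_congr rfl fun l hl => ?_
    rw [Finset.mem_Ico] at hl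
    simp [up, hl.1.not_gt, show l < k by omega]
  · intro l hl
    simp [up, Finset.mem_range.1 hl]

lemma exitProb_eq_pI (hdk : d ≤ k) {j : ℕ} (h1 : d ≤ j) (h2 : j ≤ k) :
    exitProb d k p 0 j = pI d k p (j + 1) := by
  unfold exitProb pI
  simp only [zero_add]
  rw [prod_up h1 h2]
  rcases h2.lt_or_eq with h | rfl
  · rw [if_pos ⟨by omega, by omega⟩]
    simp [up, h1.not_gt, h]
  · rw [if_neg (by omega), if_pos rfl, up_top hdk]
    simp

lemma exitProb_eq_zero {j : ℕ} (h : j < d) : exitProb d k p 0 j = 0 := by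
  simp [exitProb, up, h]

/-- Indexing by the number `j = i - 1` of ones, and adding the impossible values `j < d`, gives the
form suited to recursion over the code state. -/
lemma sum_pI_mul (hdk : d ≤ k) (f : ℕ → ℝ) :
    ∑ i ∈ Finset.Icc (d + 1) (k + 1), pI d k p i * f i =
      ∑ j ∈ Finset.range (k + 1), exitProb d k p 0 j * f (j + 1) := by
  have hs : ∑ j ∈ Finset.Icc d k, exitProb d k p 0 j * f (j + 1) =
      ∑ j ∈ Finset.range (k + 1), exitProb d k p 0 j * f (j + 1) := by
    refine Finset.sum_subset (fun j hj => ?_) fun j hj hj' => ?_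
    · rw [Finset.mem_Icc] at hj
      exact Finset.mem_range.2 (by omega)
    · rw [Finset.mem_range] at hj
      rw [Finset.mem_Icc] at hj'
      rw [exitProb_eq_zero (by omega), zero_mul]
  rw [← hs, ← Finset.map_add_right_Icc, Finset.sum_map]
  refine Finset.sum_congr rfl fun j hj => ?_
  rw [Finset.mem_Icc] at hj
  rw [exitProb_eq_pI hdk hj.1 hj.2]
  rfl

lemma sum_pI (hdk : d ≤ k) : ∑ i ∈ Finset.Icc (d + 1) (k + 1), pI d k p i = 1 := by
  have := sum_pI_mul (p := p) hdk fun _ => 1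
  simp only [mul_one] at this
  rw [this, sum_exitProb hdk k 0 (by simp)]

lemma pI_nonneg (hp : Admissible d k p) (i : ℕ) : 0 ≤ pI d k p i := by
  have hprod : ∀ j ≤ k, 0 ≤ ∏ l ∈ Finset.Ico d j, p l := fun j hj =>
    Finset.prod_nonneg fun l hl => by
      rw [Finset.mem_Ico] at hl
      exact (hp l hl.1 (by omega)).1.le
  unfold pI
  split_ifs with h1 h2
  · exact mul_nonneg (sub_nonneg.2 (hp (i - 1) (by omega) (by omega)).2.le) (hprod _ (by omega))
  · exact hprod k le_rfl
  · exact le_rfl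

lemma pI_top_pos (hp : Admissible d k p) : 0 < pI d k p (k + 1) := by
  unfold pI
  rw [if_neg (by omega), if_pos rfl]
  refine Finset.prod_pos fun l hl => ?_
  rw [Finset.mem_Ico] at hl
  exact (hp l hl.1 hl.2).1

lemma meanI_pos (hdk : d ≤ k) (hp : Admissible d k p) : 0 < meanI d k p := by
  refine Finset.sum_pos' (fun i _ => mul_nonneg i.cast_nonneg (pI_nonneg hp i))
    ⟨k + 1, Finset.mem_Icc.2 ⟨by omega, le_rfl⟩, mul_pos (by positivity) (pI_top_pos hp)⟩

end Intervals

/-! ### Binomial formulas for overflows and underflows -/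

section IntervalMeans

variable {q : ℝ} {Bmax : ℕ}

lemma intervalMean_nonneg (hq0 : 0 ≤ q) (hq1 : q ≤ 1) {Φ : ℕ → ℝ} (hΦ : ∀ b, 0 ≤ Φ b)
    (i b : ℕ) : 0 ≤ intervalMean q 0 Φ Bmax i b :=
  usageMean_nonneg hq0 hq1 fun z => by simpa [total] using hΦ _

lemma intervalMean_eq_add (r : ℕ → Bool → Bool → ℝ) (Φ : ℕ → ℝ) (c : ℝ) (i b : ℕ) :
    intervalMean q (fun b y z => r b y z - c) Φ Bmax i b =
      intervalMean q r 0 Bmax i b - c * i + intervalMean q 0 Φ Bmax i b := by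
  have : ∀ z : Fin i → Bool, total (fun b y z => r b y z - c) Bmax b (renewalWord i) (pad z) i +
      Φ (battery Bmax b (renewalWord i) (pad z) i) =
      (total r Bmax b (renewalWord i) (pad z) i + -(c * i)) +
      Φ (battery Bmax b (renewalWord i) (pad z) i) := fun z => by
    simp only [total, Finset.sum_sub_distrib, Finset.sum_const, Finset.card_range, nsmul_eq_mul]
    ring
  unfold intervalMean
  simp only [this]
  rw [usageMean_add, usageMean_add, usageMean_const]
  have hz : ∀ y z : ℕ → Bool, total 0 Bmax b y z i = 0 := fun y z => by simp [total]
  simp only [hz, Pi.zero_apply, add_zero, zero_add]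
  ring

/-- During the ones the level never drops, so an underflow can only occur at the final zero, and
only if the battery started empty and energy was used every time. -/
lemma intervalMean_underflow (hB : 1 ≤ Bmax) (m b : ℕ) (hb : b ≤ Bmax) :
    intervalMean q underflowReward 0 Bmax (m + 1) b = if b = 0 then q ^ (m + 1) else 0 := by
  induction m generalizing b with
  | zero => simp [intervalMean_one, underflowReward, usageProb]
  | succ m ih =>
    have h1 : batteryStep Bmax b true true = b := by simp [batteryStep, hb]
    have h2 : batteryStep Bmax b true false ≠ 0 := by
      simp only [batteryStep, Bool.toNat_true, Bool.toNat_false]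
      omega
    rw [intervalMean_add_two]
    simp only [Fintype.sum_bool]
    rw [ih _ (batteryStep_le _ _ _ _), ih _ (batteryStep_le _ _ _ _), h1, if_neg h2]
    simp only [underflowReward, usageProb]
    by_cases h : b = 0
    · simp [h, pow_succ']
    · simp [h]

/-- Pascal's rule, as conditioning on one of the `m + 1` trials. -/
lemma sum_binom_succ (m : ℕ) (r : ℝ) (f : ℕ → ℝ) :
    ∑ j ∈ Finset.range (m + 2), binom j (m + 1) r * f j =
      (1 - r) * ∑ j ∈ Finset.range (m + 1), binom j m r * f j +
        r * ∑ j ∈ Finset.range (m + 1), binom j m r * f (j + 1) := by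
  have hs : ∀ j, binom (j + 1) (m + 1) r = (1 - r) * binom (j + 1) m r + r * binom j m r := by
    intro j
    unfold binom
    rw [Nat.choose_succ_succ, Nat.add_sub_add_right]
    push_cast
    rcases lt_or_ge j m with h | h
    · obtain ⟨a, rfl⟩ : ∃ a, m = j + 1 + a := ⟨m - (j + 1), by omega⟩
      rw [show j + 1 + a - j = a + 1 by omega, show j + 1 + a - (j + 1) = a by omega]
      ring
    · rw [Nat.choose_eq_zero_of_lt (show m < j + 1 by omega)]
      push_cast
      ring
  have h0 : binom 0 (m + 1) r = (1 - r) * binom 0 m r := by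
    simp [binom, pow_succ, mul_comm]
  have htop : binom (m + 1) m r = 0 := by simp [binom]
  have hx : ∑ j ∈ Finset.range (m + 1), binom j m r * f j =
      ∑ j ∈ Finset.range (m + 1), binom (j + 1) m r * f (j + 1) + binom 0 m r * f 0 := by
    rw [← Finset.sum_range_succ' (fun j => binom j m r * f j), Finset.sum_range_succ _ (m + 1),
      htop, zero_mul, add_zero]
  rw [Finset.sum_range_succ', hx, h0]
  simp only [hs, add_mul, Finset.sum_add_distrib, mul_assoc, ← Finset.mul_sum]
  ring

lemma sum_binom (m : ℕ) (r : ℝ) : ∑ j ∈ Finset.range (m + 1), binom j m r = 1 := by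
  induction m with
  | zero => simp [binom]
  | succ m ih =>
    have := sum_binom_succ m r fun _ => 1
    simp only [mul_one, ih] at this
    rw [this]
    ring

lemma sum_binom_excess (m g : ℕ) (r : ℝ) :
    ∑ j ∈ Finset.range (m + 1), binom j m r * ((j - g : ℕ) : ℝ) =
      ∑ l ∈ Finset.Icc 1 (m - g), (l : ℝ) * binom (l + g) m r := by
  have h : ∑ l ∈ Finset.Icc 1 (m - g), (l : ℝ) * binom (l + g) m r =
      ∑ j ∈ Finset.Icc (1 + g) (m - g + g), binom j m r * ((j - g : ℕ) : ℝ) := by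
    rw [← Finset.map_add_right_Icc, Finset.sum_map]
    refine Finset.sum_congr rfl fun l _ => ?_
    simp [mul_comm]
  rw [h]
  refine (Finset.sum_subset ?_ ?_).symm
  · intro j hj
    rw [Finset.mem_Icc] at hj
    exact Finset.mem_range.2 (by omega)
  · intro j hj hj'
    rw [Finset.mem_range] at hj
    rw [Finset.mem_Icc] at hj'
    rw [show j - g = 0 by omega]
    simp

/-- Each unused one either fills part of the room `Bmax - b` or overflows, so the overflows are the
truncated excess of a binomial count over that room. The final zero adds none. -/
lemma intervalMean_overflow (m b : ℕ) (hb : b ≤ Bmax) :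
    intervalMean q (overflowReward Bmax) 0 Bmax (m + 1) b =
      ∑ j ∈ Finset.range (m + 1), binom j m (1 - q) * ((j - (Bmax - b) : ℕ) : ℝ) := by
  induction m generalizing b with
  | zero => simp [intervalMean_one, overflowReward]
  | succ m ih =>
    have h1 : batteryStep Bmax b true true = b := by simp [batteryStep, hb]
    rw [intervalMean_add_two, sum_binom_succ]
    simp only [Fintype.sum_bool]
    rw [ih _ (batteryStep_le _ _ _ _), ih _ (batteryStep_le _ _ _ _), h1]
    simp only [overflowReward, usageProb]
    rcases hb.lt_or_eq with h | h
    · have h2 : batteryStep Bmax b true false = b + 1 := by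
        simp only [batteryStep, Bool.toNat_true, Bool.toNat_false]
        omega
      have h3 : ∀ j, j + 1 - (Bmax - b) = j - (Bmax - (b + 1)) := fun j => by omega
      simp [h2, h3, h.ne]
    · have h2 : batteryStep Bmax b true false = b := by
        simp only [batteryStep, Bool.toNat_true, Bool.toNat_false]
        omega
      rw [h2]
      simp [h, mul_add, Finset.sum_add_distrib, sum_binom]
      ring

variable {d k : ℕ} {p : ℕ → ℝ}

lemma meanO_eq_sum (b : ℕ) : meanO d k p Bmax q b = ∑ i ∈ Finset.Icc (d + 1) (k + 1),
    pI d k p i * intervalMean q (overflowReward Bmax) 0 Bmax i b := by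
  simp only [intervalMean, Pi.zero_apply, add_zero]
  rfl

lemma meanU_eq_sum (b : ℕ) : meanU d k p Bmax q b = ∑ i ∈ Finset.Icc (d + 1) (k + 1),
    pI d k p i * intervalMean q underflowReward 0 Bmax i b := by
  simp only [intervalMean, Pi.zero_apply, add_zero]
  rfl

lemma meanO_eq (b : ℕ) (hb : b ≤ Bmax) :
    meanO d k p Bmax q b = ∑ i ∈ Finset.Icc (d + 1) (k + 1), pI d k p i *
      ∑ l ∈ Finset.Icc 1 (i - 1 - (Bmax - b)), (l : ℝ) * binom (l + (Bmax - b)) (i - 1) (1 - q) := by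
  rw [meanO_eq_sum]
  refine Finset.sum_congr rfl fun i hi => ?_
  obtain ⟨m, rfl⟩ : ∃ m, i = m + 1 := ⟨i - 1, by rw [Finset.mem_Icc] at hi; omega⟩
  rw [intervalMean_overflow _ _ hb, sum_binom_excess, Nat.add_sub_cancel]

lemma meanU_eq (hB : 1 ≤ Bmax) (b : ℕ) (hb : b ≤ Bmax) :
    meanU d k p Bmax q b = if b = 0 then
      ∑ i ∈ Finset.Icc (d + 1) (k + 1), pI d k p i * binom 0 i (1 - q) else 0 := by
  rw [meanU_eq_sum]
  split_ifs with h
  · refine Finset.sum_congr rfl fun i hi => ?_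
    obtain ⟨m, rfl⟩ : ∃ m, i = m + 1 := ⟨i - 1, by rw [Finset.mem_Icc] at hi; omega⟩
    rw [intervalMean_underflow hB _ _ hb, if_pos h]
    simp [binom]
  · refine Finset.sum_eq_zero fun i hi => ?_
    obtain ⟨m, rfl⟩ : ∃ m, i = m + 1 := ⟨i - 1, by rw [Finset.mem_Icc] at hi; omega⟩
    rw [intervalMean_underflow hB _ _ hb, if_neg h, mul_zero]

end IntervalMeans

/-! ### The battery chain at renewal instants -/

section RenewalChain

variable {d k : ℕ} {p : ℕ → ℝ} {q : ℝ} {Bmax : ℕ}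

lemma sum_renewalTrans_mul (b : Fin (Bmax + 1)) (h : ℕ → ℝ) :
    ∑ b' : Fin (Bmax + 1), renewalTrans d k p Bmax q b b' * h b' =
      ∑ i ∈ Finset.Icc (d + 1) (k + 1), pI d k p i * intervalMean q 0 h Bmax i b := by
  simp only [renewalTrans, Finset.sum_mul]
  rw [Finset.sum_comm]
  refine Finset.sum_congr rfl fun i _ => ?_
  simp only [mul_assoc]
  rw [← Finset.mul_sum]
  congr 1
  simp only [mul_comm _ (h _), ← usageMean_mul]
  rw [← usageMean_sum]
  unfold intervalMean
  congr 1
  funext z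
  have hle := battery_le (Nat.lt_succ_iff.1 b.2) (renewalWord i) (pad z) i
  rw [Finset.sum_eq_single (⟨_, Nat.lt_succ_of_le hle⟩ : Fin (Bmax + 1))]
  · simp [total]
  · intro b' _ hb'
    rw [if_neg fun h => hb' (Fin.ext h.symm), mul_zero]
  · simp

lemma renewalTrans_nonneg (hp : Admissible d k p) (hq0 : 0 ≤ q) (hq1 : q ≤ 1)
    (b b' : Fin (Bmax + 1)) : 0 ≤ renewalTrans d k p Bmax q b b' :=
  Finset.sum_nonneg fun i _ => mul_nonneg (pI_nonneg hp i)
    (usageMean_nonneg hq0 hq1 fun z => by split_ifs <;> norm_num)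

lemma renewalTrans_sum (hdk : d ≤ k) (b : Fin (Bmax + 1)) :
    ∑ b', renewalTrans d k p Bmax q b b' = 1 := by
  have := sum_renewalTrans_mul (d := d) (k := k) (p := p) (q := q) b fun _ => 1
  simpa [intervalMean, total, usageMean_one, sum_pI hdk] using this

lemma renewalTrans_pos (hdk : d ≤ k) (hp : Admissible d k p) (hq0 : 0 ≤ q) (hq1 : q ≤ 1)
    {b b' : Fin (Bmax + 1)}
    (h : 0 < intervalMean q 0 (fun c => if c = b' then 1 else 0) Bmax (k + 1) b) :
    0 < renewalTrans d k p Bmax q b b' := by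
  refine Finset.sum_pos' (fun i _ => mul_nonneg (pI_nonneg hp i)
    (usageMean_nonneg hq0 hq1 fun z => by split_ifs <;> norm_num))
    ⟨k + 1, Finset.mem_Icc.2 ⟨by omega, le_rfl⟩, mul_pos (pI_top_pos hp) ?_⟩
  simpa [intervalMean, total] using h

/-- Energy is used at every step with positive probability: the ones then keep the level and the
final zero lowers it by one. -/
lemma intervalMean_discharge_pos (hq : 0 < q) (hq1 : q ≤ 1) {Φ : ℕ → ℝ} (hΦ : ∀ b, 0 ≤ Φ b)
    (m b : ℕ) (hb : b ≤ Bmax) (h : 0 < Φ (b - 1)) : 0 < intervalMean q 0 Φ Bmax (m + 1) b := by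
  induction m with
  | zero =>
    rw [intervalMean_one]
    refine Finset.sum_pos' (fun z _ => mul_nonneg (usageProb_nonneg hq.le hq1 z)
      (by simpa using hΦ _)) ⟨true, Finset.mem_univ _, ?_⟩
    have : batteryStep Bmax b false true = b - 1 := by
      simp only [batteryStep, Bool.toNat_true, Bool.toNat_false]
      omega
    simpa [this, usageProb] using mul_pos hq h
  | succ m ih =>
    rw [intervalMean_add_two]
    refine Finset.sum_pos' (fun z _ => mul_nonneg (usageProb_nonneg hq.le hq1 z)
      (by simpa using intervalMean_nonneg hq.le hq1 hΦ _ _)) ⟨true, Finset.mem_univ _, ?_⟩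
    have : batteryStep Bmax b true true = b := by simp [batteryStep, hb]
    simpa [this, usageProb] using mul_pos hq ih

lemma intervalMean_charge {Φ : ℕ → ℝ} (m b : ℕ) (hb : b ≤ Bmax) :
    intervalMean 0 0 Φ Bmax (m + 1) b = Φ (min Bmax (b + m)) := by
  induction m generalizing b with
  | zero => simp [intervalMean_one, usageProb, batteryStep, hb]
  | succ m ih =>
    rw [intervalMean_add_two]
    simp only [Fintype.sum_bool]
    rw [ih _ (batteryStep_le _ _ _ _), ih _ (batteryStep_le _ _ _ _)]
    simp only [usageProb, batteryStep, Bool.toNat_true, Bool.toNat_false]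
    have : min Bmax (min Bmax (b + 1) + m) = min Bmax (b + (m + 1)) := by omega
    simp [this]

/-- Intervals of the maximal length `k + 1` always have positive probability. If `q > 0` they can
lower the level one by one to empty; if `q = 0 < k` each of them adds `k` until the battery is full.
-/
lemma renewalTrans_accessible (hdk : d ≤ k) (hp : Admissible d k p) (hq0 : 0 ≤ q) (hq1 : q ≤ 1)
    (hqk : 0 < q ∨ 0 < k) : ∃ a : Fin (Bmax + 1), ∀ b,
      Relation.ReflTransGen (fun i j => 0 < renewalTrans d k p Bmax q i j) b a := by
  rcases hq0.lt_or_eq with hq | rfl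
  · refine ⟨0, fun b => ?_⟩
    obtain ⟨b, hb⟩ := b
    induction b with
    | zero => exact Relation.ReflTransGen.refl
    | succ b ih =>
      refine Relation.ReflTransGen.head (b := ⟨b, by omega⟩) ?_ (ih _)
      refine renewalTrans_pos hdk hp hq0 hq1 (intervalMean_discharge_pos hq hq1
        (fun b => by split_ifs <;> norm_num) k _ (by simpa using Nat.lt_succ_iff.1 hb) ?_)
      simp
  · have hk : 0 < k := hqk.resolve_left (lt_irrefl _)
    refine ⟨Fin.last Bmax, fun b => ?_⟩
    suffices ∀ m (b : Fin (Bmax + 1)), Bmax - (b : ℕ) ≤ m →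
        Relation.ReflTransGen (fun i j => 0 < renewalTrans d k p Bmax 0 i j) b (Fin.last Bmax) from
      this _ b le_rfl
    intro m
    induction m with
    | zero =>
      intro b hb
      rw [show b = Fin.last Bmax from Fin.ext (by simp; omega)]
    | succ m ih =>
      intro b hb
      have hb' := b.2
      refine Relation.ReflTransGen.head (b := ⟨min Bmax (b + k), by omega⟩) ?_
        (ih _ (by simp; omega))
      refine renewalTrans_pos hdk hp hq0 hq1 ?_
      rw [intervalMean_charge _ _ (by omega)]
      simp

end RenewalChain

/-! ### Renewal-reward limit via the joint Poisson equation -/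

section Rates

variable {d k : ℕ} {p : ℕ → ℝ} {q : ℝ} {Bmax : ℕ} {r : ℕ → Bool → Bool → ℝ}

/-- The mean, over the rest of a renewal interval, of the total reward plus a function of the battery
level at the end of the interval; `k - m` is the present state of the code. -/
def potential (d k : ℕ) (p : ℕ → ℝ) (q : ℝ) (Bmax : ℕ) (r : ℕ → Bool → Bool → ℝ) (Φ : ℕ → ℝ) :
    ℕ → ℕ → ℝ
  | 0, b => ∑ z, usageProb q z * (r b false z + Φ (batteryStep Bmax b false z))
  | m + 1, b =>
    codeProb d k p (k - (m + 1)) true *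
        ∑ z, usageProb q z * (r b true z +
          potential d k p q Bmax r Φ m (batteryStep Bmax b true z)) +
      codeProb d k p (k - (m + 1)) false *
        ∑ z, usageProb q z * (r b false z + Φ (batteryStep Bmax b false z))

lemma potential_eq (hdk : d ≤ k) (Φ : ℕ → ℝ) (m s b : ℕ) (h : s + m = k) :
    potential d k p q Bmax r Φ m b =
      ∑ j ∈ Finset.range (m + 1), exitProb d k p s j * intervalMean q r Φ Bmax (j + 1) b := by
  induction m generalizing s b with
  | zero =>
    have : s = k := h
    simp [potential, exitProb_zero, this, up_top hdk, intervalMean_one]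
  | succ m ih =>
    have hs : k - (m + 1) = s := by omega
    rw [Finset.sum_range_succ', potential, hs]
    simp only [exitProb_succ, exitProb_zero, zero_add, intervalMean_one, codeProb, if_true,
      Bool.false_eq_true, if_false]
    congr 1
    simp only [mul_assoc]
    rw [← Finset.mul_sum]
    congr 1
    simp only [ih (s + 1) _ (by omega), intervalMean_add_two, Finset.mul_sum]
    rw [Finset.sum_comm]
    refine Finset.sum_congr rfl fun z _ => ?_
    -- The exit probabilities sum to one, so the immediate reward can be distributed over the
    -- possible run lengths.
    have h1 := sum_exitProb (p := p) hdk m (s + 1) (by omega)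
    calc usageProb q z * (r b true z + ∑ j ∈ Finset.range (m + 1), exitProb d k p (s + 1) j *
          intervalMean q r Φ Bmax (j + 1) (batteryStep Bmax b true z))
        = usageProb q z * ((∑ j ∈ Finset.range (m + 1), exitProb d k p (s + 1) j) * r b true z +
          ∑ j ∈ Finset.range (m + 1), exitProb d k p (s + 1) j *
          intervalMean q r Φ Bmax (j + 1) (batteryStep Bmax b true z)) := by rw [h1, one_mul]
      _ = _ := by
        rw [Finset.sum_mul, ← Finset.sum_add_distrib, Finset.mul_sum]
        exact Finset.sum_congr rfl fun j _ => by ring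

/-- The mean total reward over `n` channel uses, starting from code state `s` and battery level
`b`. -/
def rewardFrom (d k : ℕ) (p : ℕ → ℝ) (q : ℝ) (Bmax : ℕ) (r : ℕ → Bool → Bool → ℝ) (n : ℕ)
    (s : Fin (k + 1)) (b : ℕ) : ℝ :=
  ∑ x, wordFrom d k p n s x * usageMean q n fun z => total r Bmax b (pad x) (pad z) n

lemma rewardFrom_succ (n : ℕ) (s : Fin (k + 1)) (b : ℕ) :
    rewardFrom d k p q Bmax r (n + 1) s b = ∑ x, codeProb d k p s x * ∑ z, usageProb q z *
      (r b x z + rewardFrom d k p q Bmax r n (codeNext s x) (batteryStep Bmax b x z)) := by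
  unfold rewardFrom
  rw [sum_wordFrom_succ]
  refine Finset.sum_congr rfl fun a _ => ?_
  congr 1
  simp only [usageMean_succ, total_succ, pad_cons_zero, pad_cons_succ, usageMean_add,
    usageMean_const, Finset.mul_sum]
  rw [Finset.sum_comm]
  refine Finset.sum_congr rfl fun z _ => ?_
  have h1 := sum_wordFrom (d := d) (p := p) n (codeNext s a)
  calc _ = ∑ x, (usageProb q z * (wordFrom d k p n (codeNext s a) x * r b a z) +
        usageProb q z * (wordFrom d k p n (codeNext s a) x * usageMean q n fun z' =>
          total r Bmax (batteryStep Bmax b a z) (pad x) (pad z') n)) :=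
        Finset.sum_congr rfl fun x _ => by ring
    _ = _ := by
      rw [Finset.sum_add_distrib, ← Finset.mul_sum, ← Finset.sum_mul, h1, ← Finset.mul_sum]
      ring

/-- A solution of the Poisson equation of the joint chain of code state and battery level. -/
lemma exists_joint_poisson (hdk : d ≤ k) {c : ℝ} {h₀ : ℕ → ℝ}
    (hh : ∀ b ≤ Bmax, h₀ b = ∑ i ∈ Finset.Icc (d + 1) (k + 1),
      pI d k p i * intervalMean q (fun b y z => r b y z - c) h₀ Bmax i b) :
    ∃ h : Fin (k + 1) → ℕ → ℝ, ∀ s, ∀ b ≤ Bmax, h s b = ∑ x, codeProb d k p s x *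
      ∑ z, usageProb q z * (r b x z - c + h (codeNext s x) (batteryStep Bmax b x z)) := by
  set H := potential d k p q Bmax (fun b y z => r b y z - c) h₀ with hH
  -- This closes the loop: the potential at the start of an interval agrees with the function
  -- charged at its end.
  have htop : ∀ b ≤ Bmax, H k b = h₀ b := fun b hb => by
    rw [hh b hb, sum_pI_mul hdk, hH, potential_eq hdk h₀ k 0 b (by simp)]
  refine ⟨fun s b => H (k - s) b, fun s b hb => ?_⟩
  simp only [Fintype.sum_bool (f := fun x => codeProb d k p s x * _), codeNext_false]
  simp only [Fin.val_zero, Nat.sub_zero, htop _ (batteryStep_le _ _ _ _)]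
  rcases (Nat.lt_succ_iff.1 s.2).lt_or_eq with hs | hs
  · obtain ⟨m, hm⟩ : ∃ m, k - (s : ℕ) = m + 1 := ⟨k - s - 1, by omega⟩
    have h1 : k - (m + 1) = s := by omega
    have h2 : k - (codeNext s true : ℕ) = m := by
      have : (codeNext s true : ℕ) = s + 1 := by simp [codeNext, hs]
      omega
    rw [hm, hH, potential, h1, h2]
  · have h1 : codeProb d k p s true = 0 := by simp [codeProb, hs, up_top hdk]
    have h2 : codeProb d k p s false = 1 := by simp [codeProb, hs, up_top hdk]
    rw [h1, h2, hs, Nat.sub_self, hH, potential]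
    simp

/-- Subtracting `c * n` and `h` from the mean reward leaves a quantity that averages over one step
into itself, starting from `-h` at `n = 0`; hence it never exceeds the supremum of `|h|`. -/
lemma exists_rewardFrom_bound (hp : Admissible d k p) (hq0 : 0 ≤ q) (hq1 : q ≤ 1)
    {c : ℝ} {h : Fin (k + 1) → ℕ → ℝ}
    (hh : ∀ s, ∀ b ≤ Bmax, h s b = ∑ x, codeProb d k p s x *
      ∑ z, usageProb q z * (r b x z - c + h (codeNext s x) (batteryStep Bmax b x z))) :
    ∃ K : ℝ, ∀ n s, ∀ b ≤ Bmax, |rewardFrom d k p q Bmax r n s b - c * n| ≤ K := by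
  obtain ⟨K, hK⟩ : ∃ K : ℝ, ∀ s, ∀ b ≤ Bmax, |h s b| ≤ K := by
    refine ⟨∑ s, ∑ b ∈ Finset.range (Bmax + 1), |h s b|, fun s b hb => ?_⟩
    refine (Finset.single_le_sum (f := fun b => |h s b|) (fun _ _ => abs_nonneg _)
      (Finset.mem_range.2 (Nat.lt_succ_of_le hb))).trans ?_
    exact Finset.single_le_sum (f := fun s => ∑ b ∈ Finset.range (Bmax + 1), |h s b|)
      (fun _ _ => Finset.sum_nonneg fun _ _ => abs_nonneg _) (Finset.mem_univ s)
  have key : ∀ n s, ∀ b ≤ Bmax, |rewardFrom d k p q Bmax r n s b - c * n - h s b| ≤ K := by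
    intro n
    induction n with
    | zero =>
      intro s b hb
      simpa [rewardFrom, total, usageMean_zero, wordFrom] using hK s b hb
    | succ n ih =>
      intro s b hb
      have h1 : ∑ x, codeProb d k p s x * ∑ z, usageProb q z * (c * (n + 1)) = c * (n + 1) := by
        simp only [← Finset.sum_mul, sum_usageProb, sum_codeProb, one_mul]
      have h2 : ∑ x, codeProb d k p s x * ∑ z, usageProb q z * K = K := by
        simp only [← Finset.sum_mul, sum_usageProb, sum_codeProb, one_mul]
      have h3 : rewardFrom d k p q Bmax r (n + 1) s b - c * (n + 1 : ℕ) - h s b =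
          ∑ x, codeProb d k p s x * ∑ z, usageProb q z *
            (rewardFrom d k p q Bmax r n (codeNext s x) (batteryStep Bmax b x z) - c * n -
              h (codeNext s x) (batteryStep Bmax b x z)) := by
        rw [rewardFrom_succ, hh s b hb]
        push_cast
        rw [← h1]
        simp only [← Finset.sum_sub_distrib, ← mul_sub]
        refine Finset.sum_congr rfl fun x _ => ?_
        congr 1
        refine Finset.sum_congr rfl fun z _ => ?_
        ring
      rw [h3, ← h2]
      refine (Finset.abs_sum_le_sum_abs _ _).trans (Finset.sum_le_sum fun x _ => ?_)
      rw [abs_mul, abs_of_nonneg (codeProb_nonneg hp _ _)]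
      refine mul_le_mul_of_nonneg_left ?_ (codeProb_nonneg hp _ _)
      refine (Finset.abs_sum_le_sum_abs _ _).trans (Finset.sum_le_sum fun z _ => ?_)
      rw [abs_mul, abs_of_nonneg (usageProb_nonneg hq0 hq1 _)]
      exact mul_le_mul_of_nonneg_left (ih _ _ (batteryStep_le _ _ _ _))
        (usageProb_nonneg hq0 hq1 _)
  refine ⟨K + K, fun n s b hb => ?_⟩
  calc |rewardFrom d k p q Bmax r n s b - c * n|
      = |(rewardFrom d k p q Bmax r n s b - c * n - h s b) + h s b| := by ring_nf
    _ ≤ _ := (abs_add_le _ _).trans (add_le_add (key n s b hb) (hK s b hb))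

/-- The renewal-reward theorem for the mean reward per channel use. -/
lemma tendsto_rewardRate (hdk : d ≤ k) (hp : Admissible d k p) (hq0 : 0 ≤ q) (hq1 : q ≤ 1)
    {π : Fin (k + 1) → ℝ} (hπ : IsSteadyState (codeTrans d k p) π)
    {π' : Fin (Bmax + 1) → ℝ} (hπ' : IsSteadyState (renewalTrans d k p Bmax q) π')
    {G : ℕ → ℝ} (hG : ∀ b, G b =
      ∑ i ∈ Finset.Icc (d + 1) (k + 1), pI d k p i * intervalMean q r 0 Bmax i b)
    (hdeg : 0 < q ∨ 0 < k ∨ ∀ b ≤ Bmax, G b = 0) {b : ℕ} (hb : b ≤ Bmax) :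
    Tendsto (fun n : ℕ => (1 / (n : ℝ)) * ∑ s, π s * rewardFrom d k p q Bmax r n s b) atTop
      (𝓝 ((∑ b : Fin (Bmax + 1), π' b * G b) / meanI d k p)) := by
  set c := (∑ b : Fin (Bmax + 1), π' b * G b) / meanI d k p with hc
  have hI := meanI_pos hdk hp
  have hcI : c * meanI d k p = ∑ b : Fin (Bmax + 1), π' b * G b := div_mul_cancel₀ _ hI.ne'
  -- The cost `c` per channel use amounts to `c * meanI` per interval, which is the `π'`-mean of
  -- `G`.
  obtain ⟨h₀, hh₀⟩ : ∃ h₀ : Fin (Bmax + 1) → ℝ, ∀ b, h₀ b =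
      (G b - c * meanI d k p) + ∑ b', renewalTrans d k p Bmax q b b' * h₀ b' := by
    by_cases hqk : 0 < q ∨ 0 < k
    · obtain ⟨a, ha⟩ := renewalTrans_accessible (Bmax := Bmax) hdk hp hq0 hq1 hqk
      refine exists_poisson (renewalTrans_nonneg hp hq0 hq1) (renewalTrans_sum hdk) ha hπ' _ ?_
      simp only [mul_sub, Finset.sum_sub_distrib, ← Finset.sum_mul, hπ'.sum_eq_one, hcI]
      ring
    -- For `q = 0` and `k = 0` the Poisson equation may fail to be solvable in general, but here the
    -- reward vanishes and `0` is a solution.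
    · have hG0 : ∀ b ≤ Bmax, G b = 0 := by tauto
      have hG0' : ∀ b : Fin (Bmax + 1), G b = 0 := fun b => hG0 b (Nat.lt_succ_iff.1 b.2)
      exact ⟨0, fun b => by simp [hcI, hG0']⟩
  let h₁ : ℕ → ℝ := fun b => if hb : b < Bmax + 1 then h₀ ⟨b, hb⟩ else 0
  have h₁_eq : ∀ b : Fin (Bmax + 1), h₁ b = h₀ b := fun b => dif_pos b.2
  have h₁_poisson : ∀ b ≤ Bmax, h₁ b = ∑ i ∈ Finset.Icc (d + 1) (k + 1),
      pI d k p i * intervalMean q (fun b y z => r b y z - c) h₁ Bmax i b := by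
    intro b hb
    have e := hh₀ ⟨b, Nat.lt_succ_of_le hb⟩
    rw [← h₁_eq] at e
    simp only [← h₁_eq] at e
    rw [sum_renewalTrans_mul (⟨b, Nat.lt_succ_of_le hb⟩ : Fin (Bmax + 1)) h₁, hG] at e
    simp only at e
    rw [e]
    simp only [intervalMean_eq_add, mul_add, mul_sub, Finset.sum_add_distrib,
      Finset.sum_sub_distrib, meanI, Finset.mul_sum]
    congr 2
    exact Finset.sum_congr rfl fun i _ => by ring
  obtain ⟨h, hh⟩ := exists_joint_poisson hdk h₁_poisson
  obtain ⟨K, hK⟩ := exists_rewardFrom_bound hp hq0 hq1 hh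
  rw [tendsto_iff_dist_tendsto_zero]
  refine squeeze_zero' (Eventually.of_forall fun _ => dist_nonneg) ?_
    (tendsto_const_div_atTop_nhds_zero_nat K)
  filter_upwards [eventually_gt_atTop 0] with n hn
  have hn' : (0 : ℝ) < n := by exact_mod_cast hn
  have e : (1 / (n : ℝ)) * ∑ s, π s * rewardFrom d k p q Bmax r n s b - c =
      (∑ s, π s * (rewardFrom d k p q Bmax r n s b - c * n)) / n := by
    simp only [mul_sub, Finset.sum_sub_distrib, ← Finset.sum_mul, hπ.sum_eq_one]
    field_simp
  rw [Real.dist_eq, e, abs_div, abs_of_pos hn']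
  refine div_le_div_of_nonneg_right ?_ hn'.le
  calc |∑ s, π s * (rewardFrom d k p q Bmax r n s b - c * n)|
      ≤ ∑ s, π s * K := (Finset.abs_sum_le_sum_abs _ _).trans (Finset.sum_le_sum fun s _ => by
        rw [abs_mul, abs_of_nonneg (hπ.nonneg s)]
        exact mul_le_mul_of_nonneg_left (hK n s b hb) (hπ.nonneg s))
    _ = K := by rw [← Finset.sum_mul, hπ.sum_eq_one, one_mul]

end Rates

/-! ### Averages over random codebooks -/

section Ensemble

variable {n : ℕ} {W : (Fin n → Bool) → ℝ}

lemma sum_codebook_prod {M : ℕ} (G : Fin M → (Fin n → Bool) → ℝ) :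
    ∑ c : Fin M → Fin n → Bool, ∏ m, G m (c m) = ∏ m, ∑ x, G m x := by
  rw [Finset.prod_univ_sum, Fintype.piFinset_univ]

lemma sum_codebook_single (hW : ∑ x, W x = 1) {M : ℕ} (m : Fin M) (F : (Fin n → Bool) → ℝ) :
    ∑ c : Fin M → Fin n → Bool, (∏ j, W (c j)) * F (c m) = ∑ x, W x * F x := by
  have h := sum_codebook_prod fun (j : Fin M) x => W x * if j = m then F x else 1
  have h1 : ∀ c : Fin M → Fin n → Bool, ∏ j, (W (c j) * if j = m then F (c j) else 1) =
      (∏ j, W (c j)) * F (c m) := fun c => by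
    rw [Finset.prod_mul_distrib, Finset.prod_ite_eq' Finset.univ m]; simp
  simp only [h1] at h
  rw [h, Finset.prod_eq_single m]
  · simp
  · intro j _ hj
    simp [hj, hW]
  · simp

lemma sum_codebook_pair (hW : ∑ x, W x = 1) {M : ℕ} {m m' : Fin M} (hm : m ≠ m')
    (F F' : (Fin n → Bool) → ℝ) :
    ∑ c : Fin M → Fin n → Bool, (∏ j, W (c j)) * (F (c m) * F' (c m')) =
      (∑ x, W x * F x) * ∑ x, W x * F' x := by
  have h := sum_codebook_prod fun (j : Fin M) x =>
    W x * ((if j = m then F x else 1) * if j = m' then F' x else 1)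
  have h1 : ∀ c : Fin M → Fin n → Bool,
      ∏ j, (W (c j) * ((if j = m then F (c j) else 1) * if j = m' then F' (c j) else 1)) =
      (∏ j, W (c j)) * (F (c m) * F' (c m')) := fun c => by
    rw [Finset.prod_mul_distrib, Finset.prod_mul_distrib, Finset.prod_ite_eq' Finset.univ m,
      Finset.prod_ite_eq' Finset.univ m']; simp
  simp only [h1] at h
  rw [h, Finset.prod_eq_mul m m' hm]
  · simp [hm, hm.symm]
  · intro j _ hj
    simp [hj.1, hj.2, hW]
  · simp
  · simp

/-- Every codeword has law `W`, so averaging over the message changes nothing and `M` drops out. -/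
lemma ensembleMean_const (hW : ∑ x, W x = 1) {M : ℕ} (hM : 1 ≤ M) (F : (Fin n → Bool) → ℝ) :
    ensembleMean W M (fun c m => F (c m)) = ∑ x, W x * F x := by
  unfold ensembleMean
  have : ∀ c : Fin M → Fin n → Bool, (∏ m, W (c m)) * ((1 / (M : ℝ)) * ∑ m, F (c m)) =
      (1 / (M : ℝ)) * ∑ m, (∏ m, W (c m)) * F (c m) := fun c => by
    rw [Finset.mul_sum, Finset.mul_sum, Finset.mul_sum]
    exact Finset.sum_congr rfl fun m _ => by ring
  simp only [this]
  rw [← Finset.mul_sum, Finset.sum_comm]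
  simp only [sum_codebook_single hW]
  have : (M : ℝ) ≠ 0 := by positivity
  simp [this]

lemma sum_ensembleMean_usageMean (hW : ∑ x, W x = 1) {M : ℕ} (hM : 1 ≤ M) (Bmax b : ℕ) (q : ℝ)
    (r : ℕ → Bool → Bool → ℝ) :
    ∑ t ∈ Finset.range n, ensembleMean W M (fun c m => usageMean q n fun z =>
      r (battery Bmax b (pad (c m)) (pad z) t) (pad (c m) t) (pad z t)) =
    ∑ x, W x * usageMean q n fun z => total r Bmax b (pad x) (pad z) n := by
  have : ∀ t, ensembleMean W M (fun c m => usageMean q n fun z =>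
      r (battery Bmax b (pad (c m)) (pad z) t) (pad (c m) t) (pad z t)) =
      ∑ x, W x * usageMean q n fun z => r (battery Bmax b (pad x) (pad z) t) (pad x t) (pad z t) :=
    fun t => ensembleMean_const hW hM fun x => usageMean q n fun z =>
      r (battery Bmax b (pad x) (pad z) t) (pad x t) (pad z t)
  simp only [this]
  rw [Finset.sum_comm]
  refine Finset.sum_congr rfl fun x _ => ?_
  rw [← Finset.mul_sum]
  unfold total
  rw [usageMean_sum]

end Ensemble

/-! ### Limits of the overflow and underflow rates -/

section RateLimits

variable {d k : ℕ} {p : ℕ → ℝ} {q : ℝ} {Bmax : ℕ}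

lemma tendsto_overflowRate (hdk : d ≤ k) (hp : Admissible d k p) (hq0 : 0 ≤ q)
    (hq1 : q ≤ 1) {π : Fin (k + 1) → ℝ} (hπ : IsSteadyState (codeTrans d k p) π)
    {π' : Fin (Bmax + 1) → ℝ} (hπ' : IsSteadyState (renewalTrans d k p Bmax q) π')
    {b : ℕ} (hb : b ≤ Bmax) {M : ℕ → ℕ} (hM : ∀ n, 1 ≤ M n) :
    Tendsto (fun n => overflowRate (wordProb d k p π (n := n)) (M n) Bmax b q) atTop
      (𝓝 ((∑ b : Fin (Bmax + 1), π' b * meanO d k p Bmax q b) / meanI d k p)) := by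
  refine (tendsto_rewardRate hdk hp hq0 hq1 hπ hπ' (fun b => meanO_eq_sum b) ?_ hb).congr
    fun n => ?_
  · by_cases hk : 0 < k
    · exact Or.inr (Or.inl hk)
    -- For `k = 0` no energy is ever sent, so nothing overflows.
    · refine Or.inr (Or.inr fun b hb => ?_)
      rw [meanO_eq b hb]
      refine Finset.sum_eq_zero fun i hi => ?_
      rw [Finset.mem_Icc] at hi
      rw [Finset.Icc_eq_empty (by omega), Finset.sum_empty, mul_zero]
  · unfold overflowRate
    congr 1
    rw [eq_comm]
    refine (sum_ensembleMean_usageMean (sum_wordProb hdk hπ.sum_eq_one n) (hM n) Bmax b q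
      (overflowReward Bmax)).trans ?_
    exact sum_wordProb_mul hdk π _

lemma tendsto_underflowRate (hdk : d ≤ k) (hp : Admissible d k p) (hq0 : 0 ≤ q)
    (hq1 : q ≤ 1) (hB : 1 ≤ Bmax) {π : Fin (k + 1) → ℝ} (hπ : IsSteadyState (codeTrans d k p) π)
    {π' : Fin (Bmax + 1) → ℝ} (hπ' : IsSteadyState (renewalTrans d k p Bmax q) π')
    {b : ℕ} (hb : b ≤ Bmax) {M : ℕ → ℕ} (hM : ∀ n, 1 ≤ M n) :
    Tendsto (fun n => underflowRate (wordProb d k p π (n := n)) (M n) Bmax b q) atTop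
      (𝓝 (π' 0 * meanU d k p Bmax q 0 / meanI d k p)) := by
  have h0 : ∑ b : Fin (Bmax + 1), π' b * meanU d k p Bmax q b = π' 0 * meanU d k p Bmax q 0 := by
    rw [Finset.sum_eq_single 0]
    · rfl
    · intro b _ hb
      rw [meanU_eq hB b (Nat.lt_succ_iff.1 b.2), if_neg (show ¬(b : ℕ) = 0 from fun h => hb (Fin.ext h)), mul_zero]
    · simp
  rw [← h0]
  refine (tendsto_rewardRate hdk hp hq0 hq1 hπ hπ' (fun b => meanU_eq_sum b) ?_ hb).congr
    fun n => ?_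
  · rcases hq0.lt_or_eq with hq | rfl
    · exact Or.inl hq
    · refine Or.inr (Or.inr fun b hb => ?_)
      rw [meanU_eq hB b hb]
      split_ifs
      · refine Finset.sum_eq_zero fun i hi => ?_
        rw [Finset.mem_Icc] at hi
        simp [binom, show i ≠ 0 by omega]
      · rfl
  · unfold underflowRate
    congr 1
    rw [eq_comm]
    refine (sum_ensembleMean_usageMean (sum_wordProb hdk hπ.sum_eq_one n) (hM n) Bmax b q
      underflowReward).trans ?_
    exact sum_wordProb_mul hdk π _

end RateLimits

/-! ### Concentration of word probabilities -/

section Equipartition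

variable {d k : ℕ} {p : ℕ → ℝ}

/-- The entropy rate of the type-1 code, in bits per channel use. -/
noncomputable def entropyRate (d k : ℕ) (p : ℕ → ℝ) (π : Fin (k + 1) → ℝ) : ℝ :=
  ∑ j : Fin (k + 1), (if d ≤ (j : ℕ) ∧ (j : ℕ) < k then π j * binH (p j) else 0)

/-- The self-information, in bits, of a word emitted from state `s`. -/
noncomputable def wordInfo (d k : ℕ) (p : ℕ → ℝ) : (n : ℕ) → Fin (k + 1) → (Fin n → Bool) → ℝ
  | 0, _, _ => 0
  | n + 1, s, x =>
    -Real.logb 2 (codeProb d k p s (x 0)) + wordInfo d k p n (codeNext s (x 0)) (Fin.tail x)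

lemma wordInfo_cons {n : ℕ} (s : Fin (k + 1)) (a : Bool) (x : Fin n → Bool) :
    wordInfo d k p (n + 1) s (Fin.cons a x) =
      -Real.logb 2 (codeProb d k p s a) + wordInfo d k p n (codeNext s a) x := rfl

/-- Impossible words are excluded because `Real.logb 2 0 = 0` lets `wordInfo` ignore impossible
symbols. -/
lemma wordFrom_eq_rpow (hp : Admissible d k p) {n : ℕ} (s : Fin (k + 1)) (x : Fin n → Bool)
    (h : wordFrom d k p n s x ≠ 0) : wordFrom d k p n s x = 2 ^ (-wordInfo d k p n s x) := by
  induction n generalizing s with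
  | zero => simp [wordFrom, wordInfo]
  | succ n ih =>
    unfold wordFrom at h ⊢
    unfold wordInfo
    have h1 := left_ne_zero_of_mul h
    have h2 := right_ne_zero_of_mul h
    rw [neg_add, neg_neg, Real.rpow_add two_pos, ← ih _ _ h2,
      Real.rpow_logb two_pos (by norm_num) (lt_of_le_of_ne (codeProb_nonneg hp _ _) h1.symm)]

lemma entropyRate_eq (π : Fin (k + 1) → ℝ) :
    entropyRate d k p π =
      ∑ s, π s * ∑ x, codeProb d k p s x * -Real.logb 2 (codeProb d k p s x) := by
  refine Finset.sum_congr rfl fun s _ => ?_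
  simp only [Fintype.sum_bool, codeProb, up, binH]
  by_cases h1 : d ≤ (s : ℕ)
  · by_cases h2 : (s : ℕ) < k
    · simp [h1, h2, h1.not_gt]
      left
      ring
    · simp [h1, h2, h1.not_gt]
  · simp [h1, not_le.1 h1]

/-- The Poisson solution `h` for the one-symbol entropy turns the centred self-information into a
sum of bounded, conditionally centred increments plus boundary terms, whose second moment is at most
linear in `n`. -/
lemma exists_wordInfo_variance (hdk : d ≤ k) (hp : Admissible d k p) {π : Fin (k + 1) → ℝ}
    (hπ : IsSteadyState (codeTrans d k p) π) :
    ∃ C : ℝ, ∀ n s, ∑ x, wordFrom d k p n s x *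
      (wordInfo d k p n s x - n * entropyRate d k p π) ^ 2 ≤ C * (n + 1) := by
  set H := entropyRate d k p π with hH
  obtain ⟨h, hh⟩ := exists_poisson (codeTrans_nonneg hp) (codeTrans_sum hdk)
    (codeTrans_accessible hdk hp) hπ
    (fun s => ∑ x, codeProb d k p s x * -Real.logb 2 (codeProb d k p s x) - H) (by
      simp only [mul_sub, Finset.sum_sub_distrib, ← Finset.sum_mul, hπ.sum_eq_one]
      rw [hH, entropyRate_eq]
      ring)
  simp only [sum_codeTrans hdk] at hh
  let ξ : Fin (k + 1) → Bool → ℝ := fun s a =>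
    -Real.logb 2 (codeProb d k p s a) - H - h s + h (codeNext s a)
  have hξ : ∀ s : Fin (k + 1), ∑ a, codeProb d k p s a * ξ s a = 0 := by
    intro s
    have h1 : ∑ a, codeProb d k p s a * (H + h s) = H + h s := by
      rw [← Finset.sum_mul, sum_codeProb, one_mul]
    have h2 : ∑ a, codeProb d k p s a * ξ s a =
        ∑ a, codeProb d k p s a * -Real.logb 2 (codeProb d k p s a) +
        ∑ a, codeProb d k p s a * h (codeNext s a) - ∑ a, codeProb d k p s a * (H + h s) := by
      rw [← Finset.sum_add_distrib, ← Finset.sum_sub_distrib]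
      exact Finset.sum_congr rfl fun a _ => by simp only [ξ]; ring
    rw [h2, h1]
    linarith [hh s]
  obtain ⟨K, hK⟩ := (Set.finite_range fun s => |h s|).bddAbove
  replace hK : ∀ s, |h s| ≤ K := fun s => hK ⟨s, rfl⟩
  obtain ⟨X, hX⟩ := (Set.finite_range fun a : Fin (k + 1) × Bool => |ξ a.1 a.2|).bddAbove
  replace hX : ∀ s a, |ξ s a| ≤ X := fun s a => hX ⟨(s, a), rfl⟩
  have hX0 : 0 ≤ X := (abs_nonneg _).trans (hX 0 true)
  -- `D` is the sum of the increments `ξ` along the word minus `h` at the final state.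
  let D : ∀ n, Fin (k + 1) → (Fin n → Bool) → ℝ := fun n s x => wordInfo d k p n s x - n * H - h s
  have hD : ∀ n s a (x : Fin n → Bool),
      D (n + 1) s (Fin.cons a x) = ξ s a + D n (codeNext s a) x := by
    intro n s a x
    simp only [D, ξ, wordInfo_cons]
    push_cast
    ring
  have hmean : ∀ n s, |∑ x, wordFrom d k p n s x * D n s x| ≤ K := by
    intro n
    induction n with
    | zero => intro s; simpa [D, wordFrom, wordInfo] using hK s
    | succ n ih =>
      intro s
      have e : ∑ x, wordFrom d k p (n + 1) s x * D (n + 1) s x = ∑ a, codeProb d k p s a *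
          ∑ x, wordFrom d k p n (codeNext s a) x * D n (codeNext s a) x := by
        rw [sum_wordFrom_succ]
        simp only [hD, mul_add, Finset.sum_add_distrib, ← Finset.sum_mul, sum_wordFrom, one_mul, hξ,
          zero_add]
      rw [e]
      calc _ ≤ ∑ a, codeProb d k p s a * K :=
            (Finset.abs_sum_le_sum_abs _ _).trans (Finset.sum_le_sum fun a _ => by
              rw [abs_mul, abs_of_nonneg (codeProb_nonneg hp _ _)]
              exact mul_le_mul_of_nonneg_left (ih _) (codeProb_nonneg hp _ _))
        _ = K := by rw [← Finset.sum_mul, sum_codeProb, one_mul]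
  have hvar : ∀ n s, ∑ x, wordFrom d k p n s x * D n s x ^ 2 ≤ K ^ 2 + n * (X ^ 2 + 2 * X * K) := by
    intro n
    induction n with
    | zero =>
      intro s
      have := sq_le_sq' (by linarith [neg_abs_le (h s), hK s]) ((le_abs_self (h s)).trans (hK s))
      simpa [D, wordFrom, wordInfo] using this
    | succ n ih =>
      intro s
      rw [sum_wordFrom_succ]
      calc _ ≤ ∑ a, codeProb d k p s a *
            (X ^ 2 + 2 * X * K + (K ^ 2 + n * (X ^ 2 + 2 * X * K))) := by
            refine Finset.sum_le_sum fun a _ => mul_le_mul_of_nonneg_left ?_ (codeProb_nonneg hp _ _)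
            have e : ∑ x, wordFrom d k p n (codeNext s a) x * D (n + 1) s (Fin.cons a x) ^ 2 =
                ξ s a ^ 2 + 2 * ξ s a *
                  ∑ x, wordFrom d k p n (codeNext s a) x * D n (codeNext s a) x +
                ∑ x, wordFrom d k p n (codeNext s a) x * D n (codeNext s a) x ^ 2 := by
              have h1 : ξ s a ^ 2 = ∑ x, wordFrom d k p n (codeNext s a) x * ξ s a ^ 2 := by
                rw [← Finset.sum_mul, sum_wordFrom, one_mul]
              rw [h1, Finset.mul_sum, ← Finset.sum_add_distrib, ← Finset.sum_add_distrib]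
              refine Finset.sum_congr rfl fun x _ => ?_
              rw [hD]
              ring
            rw [e]
            have h1 : ξ s a ^ 2 ≤ X ^ 2 :=
              sq_le_sq' (by linarith [neg_abs_le (ξ s a), hX s a])
                ((le_abs_self _).trans (hX s a))
            -- The boundary term keeps the mean of `D` from vanishing, but it is bounded by `K`, so
            -- the cross term costs only a constant per step.
            have h2 : ξ s a * ∑ x, wordFrom d k p n (codeNext s a) x * D n (codeNext s a) x
                ≤ X * K := by
              refine (le_abs_self _).trans ?_
              rw [abs_mul]
              exact mul_le_mul (hX s a) (hmean n _) (abs_nonneg _) hX0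
            linarith [ih (codeNext s a)]
        _ = _ := by
          rw [← Finset.sum_mul, sum_codeProb]
          push_cast
          ring
  refine ⟨2 * (K ^ 2 + (X ^ 2 + 2 * X * K)) + 2 * K ^ 2, fun n s => ?_⟩
  have hK0 : 0 ≤ K := (abs_nonneg _).trans (hK 0)
  calc _ ≤ ∑ x, wordFrom d k p n s x * (2 * D n s x ^ 2 + 2 * K ^ 2) := by
        refine Finset.sum_le_sum fun x _ => mul_le_mul_of_nonneg_left ?_ (wordFrom_nonneg hp _ _)
        have h1 : h s ^ 2 ≤ K ^ 2 := sq_le_sq' (by linarith [neg_abs_le (h s), hK s])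
          ((le_abs_self (h s)).trans (hK s))
        have h2 : wordInfo d k p n s x - n * H = D n s x + h s := by simp only [D]; ring
        rw [h2]
        nlinarith [sq_nonneg (D n s x - h s)]
    _ = 2 * ∑ x, wordFrom d k p n s x * D n s x ^ 2 + 2 * K ^ 2 := by
        simp only [mul_add, Finset.sum_add_distrib, ← Finset.sum_mul, sum_wordFrom, one_mul,
          Finset.mul_sum]
        congr 1
        exact Finset.sum_congr rfl fun x _ => by ring
    _ ≤ _ := by
        have hn : (0 : ℝ) ≤ n := n.cast_nonneg
        have h3 : 0 ≤ X * K := mul_nonneg hX0 hK0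
        nlinarith [hvar n s, sq_nonneg K, sq_nonneg X, mul_nonneg hn (sq_nonneg K)]

lemma exists_wordInfo_tail (hdk : d ≤ k) (hp : Admissible d k p) {π : Fin (k + 1) → ℝ}
    (hπ : IsSteadyState (codeTrans d k p) π) :
    ∃ C : ℝ, ∀ n s t, 0 < t → ∑ x, wordFrom d k p n s x *
      (if t ≤ |wordInfo d k p n s x - n * entropyRate d k p π| then 1 else 0) ≤
        C * (n + 1) / t ^ 2 := by
  obtain ⟨C, hC⟩ := exists_wordInfo_variance hdk hp hπ
  refine ⟨C, fun n s t ht => ?_⟩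
  rw [le_div_iff₀ (by positivity), Finset.sum_mul]
  refine le_trans (Finset.sum_le_sum fun x _ => ?_) (hC n s)
  rw [mul_assoc]
  refine mul_le_mul_of_nonneg_left ?_ (wordFrom_nonneg hp _ _)
  split_ifs with h
  · rw [one_mul, ← sq_abs (wordInfo d k p n s x - _)]
    gcongr
  · rw [zero_mul]
    positivity

/-- Few words have a probability much above `2 ^ (-n H)`. -/
lemma exists_prob_large_le (hdk : d ≤ k) (hp : Admissible d k p) {π : Fin (k + 1) → ℝ}
    (hπ : IsSteadyState (codeTrans d k p) π) :
    ∃ C : ℝ, ∀ (n : ℕ) (t : ℝ), 0 < t → ∑ x : Fin n → Bool, wordProb d k p π x *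
      (if (2 : ℝ) ^ (-(n * entropyRate d k p π) + 2 * t) < wordProb d k p π x then 1 else 0) ≤
        C * (n + 1) / t ^ 2 + 2 ^ (-t) := by
  obtain ⟨C, hC⟩ := exists_wordInfo_tail hdk hp hπ
  refine ⟨C, fun n t ht => ?_⟩
  rw [sum_wordProb_mul hdk]
  have key : ∀ s, ∑ x : Fin n → Bool, wordFrom d k p n s x *
      (if (2 : ℝ) ^ (-(n * entropyRate d k p π) + 2 * t) < wordProb d k p π x then 1 else 0) ≤
        C * (n + 1) / t ^ 2 + 2 ^ (-t) := by
    intro s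
    have e : (2 : ℝ) ^ (-t) = ∑ x : Fin n → Bool, 2 ^ (-t) * wordProb d k p π x := by
      rw [← Finset.mul_sum, sum_wordProb hdk hπ.sum_eq_one, mul_one]
    refine le_trans ?_ (add_le_add (hC n s t ht) e.ge)
    rw [← Finset.sum_add_distrib]
    refine Finset.sum_le_sum fun x _ => ?_
    have hw := wordFrom_nonneg hp s x
    have hW := wordProb_nonneg hdk hp hπ.nonneg x
    have h2 : (0 : ℝ) < 2 ^ (-t) := by positivity
    by_cases h1 : (2 : ℝ) ^ (-(n * entropyRate d k p π) + 2 * t) < wordProb d k p π x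
    · by_cases h3 : t ≤ |wordInfo d k p n s x - n * entropyRate d k p π|
      · rw [if_pos h1, if_pos h3]
        linarith [mul_nonneg h2.le hW]
      · rw [if_pos h1, if_neg h3, mul_one, mul_zero, zero_add]
        rcases eq_or_ne (wordFrom d k p n s x) 0 with h4 | h4
        · rw [h4]
          exact mul_nonneg h2.le hW
        · have h5 := (abs_lt.1 (not_le.1 h3)).1
          -- Change of measure: a typical word has `wordFrom` at most `2 ^ (-n H + t)`, which is
          -- below `2 ^ (-t)` times its `wordProb`.
          refine le_trans ?_ (mul_le_mul_of_nonneg_left h1.le h2.le)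
          rw [wordFrom_eq_rpow hp s x h4, ← Real.rpow_add two_pos]
          exact Real.rpow_le_rpow_of_exponent_le one_le_two (by linarith)
    · rw [if_neg h1, mul_zero]
      exact add_nonneg (mul_nonneg hw (by split_ifs <;> norm_num)) (mul_nonneg h2.le hW)
  calc _ ≤ ∑ s, π s * (C * (n + 1) / t ^ 2 + 2 ^ (-t)) :=
        Finset.sum_le_sum fun s _ => mul_le_mul_of_nonneg_left (key s) (hπ.nonneg s)
    _ = _ := by rw [← Finset.sum_mul, hπ.sum_eq_one, one_mul]

/-- Few words have a probability much below `2 ^ (-n H)`. -/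
lemma exists_prob_small_le (hdk : d ≤ k) (hp : Admissible d k p) {π : Fin (k + 1) → ℝ}
    (hπ : IsSteadyState (codeTrans d k p) π) :
    ∃ C : ℝ, ∀ (n : ℕ) (t : ℝ), 0 < t → ∑ x : Fin n → Bool, wordProb d k p π x *
      (if wordProb d k p π x < (2 : ℝ) ^ (-(n * entropyRate d k p π) - 2 * t) then 1 else 0) ≤
        C * (n + 1) / t ^ 2 + (k + 1) * 2 ^ (-t) := by
  obtain ⟨C, hC⟩ := exists_wordInfo_tail hdk hp hπ
  refine ⟨C, fun n t ht => ?_⟩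
  rw [sum_wordProb_mul hdk]
  have key : ∀ s, π s * ∑ x : Fin n → Bool, wordFrom d k p n s x *
      (if wordProb d k p π x < (2 : ℝ) ^ (-(n * entropyRate d k p π) - 2 * t) then 1 else 0) ≤
        π s * (C * (n + 1) / t ^ 2) + 2 ^ (-t) := by
    intro s
    have e : (2 : ℝ) ^ (-t) = ∑ x : Fin n → Bool, 2 ^ (-t) * wordFrom d k p n s x := by
      rw [← Finset.mul_sum, sum_wordFrom, mul_one]
    refine le_trans ?_ (add_le_add (mul_le_mul_of_nonneg_left (hC n s t ht) (hπ.nonneg s)) e.ge)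
    rw [Finset.mul_sum, Finset.mul_sum, ← Finset.sum_add_distrib]
    refine Finset.sum_le_sum fun x _ => ?_
    have hw := wordFrom_nonneg hp s x
    have hs := hπ.nonneg s
    have h2 : (0 : ℝ) < 2 ^ (-t) := by positivity
    by_cases h1 : wordProb d k p π x < (2 : ℝ) ^ (-(n * entropyRate d k p π) - 2 * t)
    · by_cases h3 : t ≤ |wordInfo d k p n s x - n * entropyRate d k p π|
      · rw [if_pos h1, if_pos h3]
        linarith [mul_nonneg h2.le hw]
      · rw [if_pos h1, if_neg h3, mul_one, mul_zero, mul_zero, zero_add]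
        rcases eq_or_ne (wordFrom d k p n s x) 0 with h4 | h4
        · rw [h4, mul_zero, mul_zero]
        · have h5 := (abs_lt.1 (not_le.1 h3)).2
          -- The total probability dominates the part from `s`, while typicality bounds `wordFrom`
          -- below by `2 ^ (-n H - t)`. Each of the `k + 1` initial states thus contributes at most
          -- `2 ^ (-t)`.
          have h6 : π s * wordFrom d k p n s x ≤ wordProb d k p π x := by
            rw [wordProb_eq hdk]
            exact Finset.single_le_sum (f := fun s => π s * wordFrom d k p n s x)
              (fun s _ => mul_nonneg (hπ.nonneg s) (wordFrom_nonneg hp s x)) (Finset.mem_univ s)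
          refine h6.trans (h1.le.trans ?_)
          rw [wordFrom_eq_rpow hp s x h4, ← Real.rpow_add two_pos]
          exact Real.rpow_le_rpow_of_exponent_le one_le_two (by linarith)
    · rw [if_neg h1, mul_zero, mul_zero]
      exact add_nonneg (mul_nonneg hs (mul_nonneg hw (by split_ifs <;> norm_num)))
        (mul_nonneg h2.le hw)
  calc _ ≤ ∑ s, (π s * (C * (n + 1) / t ^ 2) + 2 ^ (-t)) := Finset.sum_le_sum fun s _ => key s
    _ = _ := by
      rw [Finset.sum_add_distrib, ← Finset.sum_mul, hπ.sum_eq_one, one_mul]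
      simp

end Equipartition

/-! ### Random coding and strong converse at finite length -/

section Coding

variable {n : ℕ} {W : (Fin n → Bool) → ℝ}

/-- Random coding over the noiseless channel: errors are caused by collisions of codewords. -/
lemma exists_decoder_errorProb_le (hW0 : ∀ x, 0 ≤ W x) (hW : ∑ x, W x = 1) {M : ℕ} (hM : 1 ≤ M)
    {θ : ℝ} (hθ : 0 ≤ θ) : ∃ g : (Fin M → Fin n → Bool) → (Fin n → Bool) → Fin M,
      errorProb W M g ≤ ∑ x, W x * (if θ < W x then 1 else 0) + (M - 1) * θ := by
  classical
  let g : (Fin M → Fin n → Bool) → (Fin n → Bool) → Fin M := fun c y =>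
    if h : ∃ m, c m = y then h.choose else ⟨0, hM⟩
  have hg : ∀ (c : Fin M → Fin n → Bool) m, c (g c (c m)) = c m := fun c m => by
    have h : ∃ m', c m' = c m := ⟨m, rfl⟩
    simp only [g, dif_pos h]
    exact h.choose_spec
  refine ⟨g, ?_⟩
  have hpt : ∀ (c : Fin M → Fin n → Bool) m, (if g c (c m) = m then (0 : ℝ) else 1) ≤
      (if θ < W (c m) then 1 else 0) + ∑ m' ∈ Finset.univ.erase m, ∑ x,
        (if θ < W x then (0 : ℝ) else 1) *
          ((if c m = x then 1 else 0) * (if c m' = x then 1 else 0)) := by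
    intro c m
    have hnn : ∀ m' x, (0 : ℝ) ≤ (if θ < W x then (0 : ℝ) else 1) *
        ((if c m = x then 1 else 0) * (if c m' = x then 1 else 0)) := fun m' x => by
      split_ifs <;> norm_num
    have hs : (0 : ℝ) ≤ ∑ m' ∈ Finset.univ.erase m, ∑ x, (if θ < W x then (0 : ℝ) else 1) *
        ((if c m = x then 1 else 0) * (if c m' = x then 1 else 0)) :=
      Finset.sum_nonneg fun m' _ => Finset.sum_nonneg fun x _ => hnn m' x
    by_cases h1 : g c (c m) = m
    · rw [if_pos h1]
      exact add_nonneg (by split_ifs <;> norm_num) hs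
    · rw [if_neg h1]
      by_cases h2 : θ < W (c m)
      · rw [if_pos h2]
        linarith
      · rw [if_neg h2, zero_add]
        -- The wrong answer `g c (c m)` is itself an index whose codeword collides with `c m`; the
        -- other terms of the union bound are dropped.
        refine le_trans ?_ (Finset.single_le_sum
          (fun m' _ => Finset.sum_nonneg fun x _ => hnn m' x)
          (Finset.mem_erase.2 ⟨h1, Finset.mem_univ _⟩))
        refine le_trans ?_ (Finset.single_le_sum (fun x _ => hnn _ x) (Finset.mem_univ (c m)))
        simp [h2, hg c m]
  have hprod : ∀ c : Fin M → Fin n → Bool, 0 ≤ ∏ j, W (c j) := fun c =>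
    Finset.prod_nonneg fun j _ => hW0 _
  have hm : ∀ m, ∑ c, (∏ j, W (c j)) * (if g c (c m) = m then (0 : ℝ) else 1) ≤
      ∑ x, W x * (if θ < W x then 1 else 0) + (M - 1) * θ := by
    intro m
    refine (Finset.sum_le_sum fun c _ => mul_le_mul_of_nonneg_left (hpt c m) (hprod c)).trans ?_
    simp only [mul_add, Finset.sum_add_distrib]
    rw [sum_codebook_single hW m fun x => if θ < W x then 1 else 0]
    refine add_le_add le_rfl ?_
    simp only [Finset.mul_sum]
    rw [Finset.sum_comm]
    calc _ ≤ ∑ m' ∈ Finset.univ.erase m, θ := Finset.sum_le_sum fun m' hm' => by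
          rw [Finset.sum_comm]
          have hne : m ≠ m' := (Finset.ne_of_mem_erase hm').symm
          -- Two independent codewords both equal `x` with probability `W x * W x`, and only words
          -- with `W x ≤ θ` are counted.
          calc _ ≤ ∑ x, θ * W x := Finset.sum_le_sum fun x _ => by
                simp only [mul_left_comm _ (if θ < W x then (0 : ℝ) else 1)]
                rw [← Finset.mul_sum, sum_codebook_pair hW hne (fun y => if y = x then 1 else 0)
                  (fun y => if y = x then 1 else 0)]
                simp only [mul_ite, mul_one, mul_zero, Finset.sum_ite_eq', Finset.mem_univ, if_true]
                split_ifs with h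
                · rw [zero_mul]
                  exact mul_nonneg hθ (hW0 x)
                · rw [one_mul]
                  exact mul_le_mul_of_nonneg_right (not_lt.1 h) (hW0 x)
            _ = θ := by rw [← Finset.mul_sum, hW, mul_one]
      _ = (M - 1) * θ := by
          rw [Finset.sum_const, Finset.card_erase_of_mem (Finset.mem_univ m), Finset.card_univ,
            Fintype.card_fin, nsmul_eq_mul, Nat.cast_sub hM, Nat.cast_one]
  have hM' : (0 : ℝ) < M := by exact_mod_cast hM
  unfold errorProb ensembleMean
  have e : ∀ c : Fin M → Fin n → Bool,
      (∏ m, W (c m)) * ((1 / (M : ℝ)) * ∑ m, if g c (c m) = m then (0 : ℝ) else 1) =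
      (1 / (M : ℝ)) * ∑ m, (∏ m, W (c m)) * if g c (c m) = m then (0 : ℝ) else 1 := fun c => by
    rw [Finset.mul_sum, Finset.mul_sum, Finset.mul_sum]
    exact Finset.sum_congr rfl fun m _ => by ring
  simp only [e]
  rw [← Finset.mul_sum, Finset.sum_comm, one_div, inv_mul_le_iff₀ hM']
  refine (Finset.sum_le_sum fun m _ => hm m).trans (le_of_eq ?_)
  rw [Finset.sum_const, Finset.card_univ, Fintype.card_fin, nsmul_eq_mul]

/-- Strong converse over the noiseless channel: the messages that are decoded correctly have
distinct codewords. -/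
lemma le_errorProb (hW0 : ∀ x, 0 ≤ W x) (hW : ∑ x, W x = 1) {M : ℕ} (hM : 1 ≤ M) {θ : ℝ}
    (hθ : 0 < θ) (g : (Fin M → Fin n → Bool) → (Fin n → Bool) → Fin M) :
    1 - θ⁻¹ / M - ∑ x, W x * (if W x < θ then 1 else 0) ≤ errorProb W M g := by
  classical
  have hM' : (0 : ℝ) < M := by exact_mod_cast hM
  -- Total mass one leaves room for at most `θ⁻¹` words of probability at least `θ`.
  have hA : ((Finset.univ.filter fun x => θ ≤ W x).card : ℝ) ≤ θ⁻¹ := by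
    rw [← one_div, le_div_iff₀ hθ, ← hW, ← nsmul_eq_mul]
    exact (Finset.card_nsmul_le_sum _ _ _ fun x hx => (Finset.mem_filter.1 hx).2).trans
      (Finset.sum_le_univ_sum_of_nonneg hW0)
  have hpt : ∀ c : Fin M → Fin n → Bool, (M : ℝ) - θ⁻¹ - ∑ m, (if W (c m) < θ then 1 else 0) ≤
      ∑ m, if g c (c m) = m then (0 : ℝ) else 1 := by
    intro c
    set S := Finset.univ.filter fun m => g c (c m) = m ∧ θ ≤ W (c m) with hS
    -- On correctly decoded messages the codebook is injective, since the decoder inverts it.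
    have hcard : (S.card : ℝ) ≤ θ⁻¹ := by
      refine le_trans ?_ hA
      refine Nat.cast_le.2 (Finset.card_le_card_of_injOn c ?_ ?_)
      · intro m hm
        simp only [hS, Finset.coe_filter, Finset.mem_univ, true_and, Set.mem_ofPred_eq] at hm ⊢
        exact hm.2
      · intro m hm m' hm' h
        simp only [hS, Finset.coe_filter, Finset.mem_univ, true_and, Set.mem_ofPred_eq] at hm hm'
        rw [← hm.1, h, hm'.1]
    have h1 : (M : ℝ) ≤ ∑ m : Fin M, ((if g c (c m) = m ∧ θ ≤ W (c m) then 1 else 0) +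
        (if W (c m) < θ then 1 else 0) + if g c (c m) = m then (0 : ℝ) else 1) := by
      calc (M : ℝ) = ∑ m : Fin M, (1 : ℝ) := by simp
        _ ≤ _ := Finset.sum_le_sum fun m _ => by
          by_cases h2 : g c (c m) = m
          · by_cases h3 : θ ≤ W (c m)
            · simp [h2, h3, h3.not_gt]
            · simp [h2, not_le.1 h3, h3]
          · simp only [h2, false_and, if_false, zero_add]
            split_ifs <;> norm_num
    rw [Finset.sum_add_distrib, Finset.sum_add_distrib, Finset.sum_boole] at h1
    linarith
  have hprod : ∀ c : Fin M → Fin n → Bool, 0 ≤ ∏ j, W (c j) := fun c =>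
    Finset.prod_nonneg fun j _ => hW0 _
  have hone : ∑ c : Fin M → Fin n → Bool, ∏ j, W (c j) = 1 := by
    rw [sum_codebook_prod fun (_ : Fin M) x => W x]
    simp [hW]
  rw [← ensembleMean_const hW hM fun x => if W x < θ then 1 else 0]
  have e : 1 - θ⁻¹ / M = ∑ c : Fin M → Fin n → Bool, (∏ j, W (c j)) * (1 - θ⁻¹ / M) := by
    rw [← Finset.sum_mul, hone, one_mul]
  rw [e]
  unfold errorProb ensembleMean
  rw [← Finset.sum_sub_distrib]
  refine Finset.sum_le_sum fun c _ => ?_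
  rw [← mul_sub]
  refine mul_le_mul_of_nonneg_left ?_ (hprod c)
  have := mul_le_mul_of_nonneg_left (hpt c) (one_div_nonneg.2 hM'.le)
  refine le_trans (le_of_eq ?_) this
  field_simp

end Coding

/-! ### Asymptotics of the slack -/

section Asymptotics

/-- The slack in the exponents, which is between the orders `n ^ (1/2)` and `n`. -/
noncomputable def slack (n : ℕ) : ℝ := ((n : ℝ) + 1) ^ (3 / 4 : ℝ)

lemma slack_pos (n : ℕ) : 0 < slack n := by unfold slack; positivity

lemma tendsto_add_one_rpow {a : ℝ} (ha : 0 < a) :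
    Tendsto (fun n : ℕ => ((n : ℝ) + 1) ^ a) atTop atTop :=
  (tendsto_rpow_atTop ha).comp (tendsto_atTop_add_const_right _ _ tendsto_natCast_atTop_atTop)

lemma tendsto_two_rpow_neg {u : ℕ → ℝ} (hu : Tendsto u atTop atTop) :
    Tendsto (fun n => (2 : ℝ) ^ (-u n)) atTop (𝓝 0) := by
  have h := (tendsto_rpow_atTop_of_base_lt_one (2⁻¹ : ℝ) (by norm_num) (by norm_num)).comp hu
  refine h.congr fun n => ?_
  simp only [Function.comp]
  rw [Real.inv_rpow two_pos.le, Real.rpow_neg two_pos.le]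

lemma tendsto_slack : Tendsto slack atTop atTop := tendsto_add_one_rpow (by norm_num)

lemma tendsto_div_slack_sq (C : ℝ) :
    Tendsto (fun n : ℕ => C * (n + 1) / slack n ^ 2) atTop (𝓝 0) := by
  have h := (tendsto_const_nhds (x := C)).div_atTop
    (tendsto_add_one_rpow (show (0 : ℝ) < 1 / 2 by norm_num))
  refine h.congr fun n => ?_
  have hn : (0 : ℝ) < (n : ℝ) + 1 := by positivity
  have e : slack n ^ 2 = ((n : ℝ) + 1) * ((n : ℝ) + 1) ^ (1 / 2 : ℝ) := by
    unfold slack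
    rw [← Real.rpow_natCast, ← Real.rpow_mul hn.le, ← Real.rpow_one_add' hn.le (by norm_num)]
    norm_num
  rw [e]
  field_simp

lemma eventually_slack_le {ε : ℝ} (hε : 0 < ε) : ∀ᶠ n : ℕ in atTop, slack n ≤ ε * n := by
  filter_upwards [(tendsto_add_one_rpow (show (0 : ℝ) < 1 / 4 by norm_num)).eventually_ge_atTop
    (2 / ε), eventually_ge_atTop 1] with n h1 h2
  have hn : (0 : ℝ) < (n : ℝ) + 1 := by positivity
  have hn1 : (1 : ℝ) ≤ n := by exact_mod_cast h2
  have e : slack n * ((n : ℝ) + 1) ^ (1 / 4 : ℝ) = (n : ℝ) + 1 := by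
    unfold slack
    rw [← Real.rpow_add hn]
    norm_num
  have h3 : slack n * (2 / ε) ≤ (n : ℝ) + 1 :=
    (mul_le_mul_of_nonneg_left h1 (slack_pos n).le).trans e.le
  rw [mul_div_assoc', div_le_iff₀ hε] at h3
  nlinarith

end Asymptotics

/-! ### The entropy rate as the threshold for reliable decoding -/

section Capacity

variable {d k : ℕ} {p : ℕ → ℝ} {π : Fin (k + 1) → ℝ}

lemma exists_code (hdk : d ≤ k) (hp : Admissible d k p)
    (hπ : IsSteadyState (codeTrans d k p) π) {R : ℝ} (hR : R ≤ entropyRate d k p π) :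
    ∃ (M : ℕ → ℕ) (g : ∀ n, (Fin (M n) → Fin n → Bool) → (Fin n → Bool) → Fin (M n)),
      (∀ n, 1 ≤ M n) ∧ (∀ R' < R, ∀ᶠ n : ℕ in atTop, (2 : ℝ) ^ ((n : ℝ) * R') ≤ (M n : ℝ)) ∧
      Tendsto (fun n => errorProb (wordProb d k p π (n := n)) (M n) (g n)) atTop (𝓝 0) := by
  set H := entropyRate d k p π
  obtain ⟨C, hC⟩ := exists_prob_large_le hdk hp hπ
  -- Two slacks pay for the threshold `θ = 2 ^ (-n H + 2 slack)`; the third makes the collision term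
  -- at most `2 ^ (-slack)`.
  let M : ℕ → ℕ := fun n => ⌈(2 : ℝ) ^ (n * H - 3 * slack n)⌉₊
  have hM : ∀ n, 1 ≤ M n := fun n => Nat.one_le_ceil_iff.2 (by positivity)
  choose g hg using fun n => exists_decoder_errorProb_le (n := n)
    (fun x => wordProb_nonneg hdk hp hπ.nonneg x) (sum_wordProb hdk hπ.sum_eq_one n) (hM n)
    (Real.rpow_nonneg two_pos.le (-(n * H) + 2 * slack n))
  refine ⟨M, g, hM, fun R' hR' => ?_, ?_⟩
  · have hε : 0 < (H - R') / 3 := by linarith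
    filter_upwards [eventually_slack_le hε] with n hn
    refine le_trans (Real.rpow_le_rpow_of_exponent_le one_le_two ?_) (Nat.le_ceil _)
    linarith
  · have hlim := ((tendsto_div_slack_sq C).add (tendsto_two_rpow_neg tendsto_slack)).add
      (tendsto_two_rpow_neg tendsto_slack)
    simp only [add_zero] at hlim
    refine squeeze_zero (fun n => ?_) (fun n => ?_) hlim
    · refine Finset.sum_nonneg fun c _ => mul_nonneg
        (Finset.prod_nonneg fun m _ => wordProb_nonneg hdk hp hπ.nonneg _)
        (mul_nonneg (by positivity) (Finset.sum_nonneg fun m _ => by beta_reduce; split_ifs <;> norm_num))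
    · refine (hg n).trans (add_le_add (hC n _ (slack_pos n)) ?_)
      have h1 : (M n : ℝ) - 1 ≤ (2 : ℝ) ^ (n * H - 3 * slack n) := by
        have := Nat.ceil_lt_add_one (a := (2 : ℝ) ^ (n * H - 3 * slack n)) (by positivity)
        simp only [M]
        linarith
      refine (mul_le_mul_of_nonneg_right h1 (by positivity)).trans (le_of_eq ?_)
      rw [← Real.rpow_add two_pos]
      congr 1
      ring

lemma rate_le_entropyRate (hdk : d ≤ k) (hp : Admissible d k p)
    (hπ : IsSteadyState (codeTrans d k p) π) {R : ℝ} {M : ℕ → ℕ}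
    {g : ∀ n, (Fin (M n) → Fin n → Bool) → (Fin n → Bool) → Fin (M n)} (hM : ∀ n, 1 ≤ M n)
    (hR : ∀ R' < R, ∀ᶠ n : ℕ in atTop, (2 : ℝ) ^ ((n : ℝ) * R') ≤ (M n : ℝ))
    (herr : Tendsto (fun n => errorProb (wordProb d k p π (n := n)) (M n) (g n)) atTop (𝓝 0)) :
    R ≤ entropyRate d k p π := by
  set H := entropyRate d k p π
  by_contra! hlt
  obtain ⟨C, hC⟩ := exists_prob_small_le hdk hp hπ
  obtain ⟨R', hR1, hR2⟩ := exists_between hlt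
  have hlim := (((tendsto_two_rpow_neg tendsto_slack).const_sub 1).sub
    ((tendsto_div_slack_sq C).add ((tendsto_two_rpow_neg tendsto_slack).const_mul ((k : ℝ) + 1))))
  have hle := le_of_tendsto_of_tendsto hlim herr (by
    -- Eventually `n R' ≥ n H + 3 slack`, so with `θ = 2 ^ (-n H - 2 slack)` the term `θ⁻¹ / M n` is
    -- at most `2 ^ (-slack)`; the error bound then tends to one.
    have hε : 0 < (R' - H) / 3 := by linarith
    filter_upwards [hR R' hR2, eventually_slack_le hε] with n h1 h2
    have hθ : (0 : ℝ) < 2 ^ (-(n * H) - 2 * slack n) := by positivity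
    refine le_trans (sub_le_sub (sub_le_sub le_rfl ?_) (hC n _ (slack_pos n)))
      (le_errorProb (fun x => wordProb_nonneg hdk hp hπ.nonneg x)
        (sum_wordProb hdk hπ.sum_eq_one n) (hM n) hθ (g n))
    have hMp : (0 : ℝ) < M n := by exact_mod_cast hM n
    rw [div_le_iff₀ hMp, ← Real.rpow_neg two_pos.le]
    refine le_trans ?_ (mul_le_mul_of_nonneg_left h1 (by positivity))
    rw [← Real.rpow_add two_pos]
    exact Real.rpow_le_rpow_of_exponent_le one_le_two (by linarith))
  norm_num at hle

end Capacity

end EnergyRLL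

theorem proposition2 (d k Bmax b₀ : ℕ) (q : ℝ) (hdk : d ≤ k) (hB : 1 ≤ Bmax) (hb₀ : b₀ ≤ Bmax)
    (hq0 : 0 ≤ q) (hq1 : q ≤ 1) :
    -- the steady states are well defined, and the binomial formulas hold
    (∀ p : ℕ → ℝ, Admissible d k p →
      (∃! π : Fin (k + 1) → ℝ, IsSteadyState (codeTrans d k p) π) ∧
      (∃ π' : Fin (Bmax + 1) → ℝ, IsSteadyState (renewalTrans d k p Bmax q) π') ∧
      (0 < q ∨ 0 < k → ∃! π' : Fin (Bmax + 1) → ℝ, IsSteadyState (renewalTrans d k p Bmax q) π') ∧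
      meanU d k p Bmax q 0 = ∑ i ∈ Finset.Icc (d + 1) (k + 1), pI d k p i * binom 0 i (1 - q) ∧
      (∀ b ≤ Bmax, meanO d k p Bmax q b = ∑ i ∈ Finset.Icc (d + 1) (k + 1), pI d k p i *
        ∑ l ∈ Finset.Icc 1 (i - 1 - (Bmax - b)),
          (l : ℝ) * binom (l + (Bmax - b)) (i - 1) (1 - q))) ∧
    -- the set of achievable triples
    achievableTriples d k Bmax b₀ q =
      {T : ℝ × ℝ × ℝ | ∃ (p : ℕ → ℝ) (π : Fin (k + 1) → ℝ) (π' : Fin (Bmax + 1) → ℝ),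
        Admissible d k p ∧ IsSteadyState (codeTrans d k p) π ∧
        IsSteadyState (renewalTrans d k p Bmax q) π' ∧
        T.1 ≤ ∑ j : Fin (k + 1), (if d ≤ (j : ℕ) ∧ (j : ℕ) < k then π j * binH (p j) else 0) ∧
        (∑ b : Fin (Bmax + 1), π' b * meanO d k p Bmax q b) / meanI d k p ≤ T.2.1 ∧
        π' 0 * meanU d k p Bmax q 0 / meanI d k p ≤ T.2.2} := by
  have hex : ∀ p, Admissible d k p → ∃ π' : Fin (Bmax + 1) → ℝ,
      IsSteadyState (renewalTrans d k p Bmax q) π' := fun p hp =>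
    exists_isSteadyState (renewalTrans_nonneg hp hq0 hq1) (renewalTrans_sum hdk)
  refine ⟨fun p hp => ⟨?_, hex p hp, fun hqk => ?_, ?_, fun b hb => meanO_eq b hb⟩, ?_⟩
  · exact existsUnique_isSteadyState (codeTrans_nonneg hp) (codeTrans_sum hdk)
      (codeTrans_accessible hdk hp)
  · obtain ⟨a, ha⟩ := renewalTrans_accessible (Bmax := Bmax) hdk hp hq0 hq1 hqk
    exact existsUnique_isSteadyState (renewalTrans_nonneg hp hq0 hq1) (renewalTrans_sum hdk) ha
  · rw [meanU_eq hB 0 (Nat.zero_le _), if_pos rfl]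
  · ext T
    constructor
    · rintro ⟨p, π, hp, hπ, M, g, hM, hR, herr, hO, hU⟩
      -- Any steady state serves, since the limits of the two rates are expressed by the same
      -- formula for each of them.
      obtain ⟨π', hπ'⟩ := hex p hp
      rw [(tendsto_overflowRate hdk hp hq0 hq1 hπ hπ' hb₀ hM).limsup_eq] at hO
      rw [(tendsto_underflowRate hdk hp hq0 hq1 hB hπ hπ' hb₀ hM).limsup_eq] at hU
      exact ⟨p, π, π', hp, hπ, hπ', rate_le_entropyRate hdk hp hπ hM hR herr, hO, hU⟩
    · rintro ⟨p, π, π', hp, hπ, hπ', hR, hO, hU⟩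
      obtain ⟨M, g, hM, hMR, herr⟩ := exists_code hdk hp hπ hR
      refine ⟨p, π, hp, hπ, M, g, hM, hMR, herr, ?_, ?_⟩
      · rwa [(tendsto_overflowRate hdk hp hq0 hq1 hπ hπ' hb₀ hM).limsup_eq]
      · rwa [(tendsto_underflowRate hdk hp hq0 hq1 hB hπ hπ' hb₀ hM).limsup_eq]
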